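/- Consider an economy of overlapping generations whose members live for two periods and have logarithmic utility. There are $I\ge 2$ endowment states, independently and identically distributed over time with probabilities $\pi(r)>0$. In a state the young own the share $s\in(0,1)$ of the aggregate endowment and the old own $1-s$; a state is identified with its share, and $s(1)<\dots<s(I)$. Let $\beta\in(0,1]$ be the generational and $\delta\in(0,1)$ the planner's discount factor. Put $\hat\upsilon(s)=\log s+\beta\sum_r\pi(r)\log(1-r)$. A history-contingent rule for the consumption share $c>0$ of the young is sustainable if after every history, with current state $s$, $c\le s$ and $\log c+\beta\sum_r\pi(r)\log(1-c_r)\ge\hat\upsilon(s)$, where $c_r$ is next period's share in state $r$. Let $\omega_{\min}(s)=\log(1-s)$, let $\omega_{\max}(s)$ be the largest utility $\log(1-c_0)$ of the initial old that a sustainable rule delivers when the initial state is $s$, and let $\Omega(s)=[\omega_{\min}(s),\omega_{\max}(s)]$. Let $V(s,\omega)$ be the supremum of $\mathbb E\sum_{t\ge0}\delta^t\big(\tfrac{\beta}{\delta}\log(1-c_t)+\log c_t\big)$ over the sustainable rules with $\log(1-c_0)\ge\omega$, when the initial state is $s$. For $\omega\in\Omega(s)$ consider the recursive problem $$\max_{c,(\omega_r)}\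 \tfrac{\beta}{\delta}\log(1-c)+\log c+\delta\sum_r\pi(r)V(r,\omega_r)$$ subject to $\log(1-c)\ge\omega$, $0<c\le s$, $\omega_r\in\Omega(r)$ for every $r$, and $\log c+\beta\sum_r\pi(r)\omega_r\ge\hat\upsilon(s)$. Let $f(s,\omega)$ be the optimal $c$ and $g_r(s,\omega)$ the optimal promises (the largest ones, if several are optimal). Let $\omega^0(s)$ be the largest maximizer of $V(s,\cdot)$ on $\Omega(s)$, $c^0(s)=f(s,\omega^0(s))$, $c^*(s)=\min\{\delta/(\beta+\delta),s\}$ (the first best) and $\omega^*(s)=\log(1-c^*(s))$. Assume that $\sum_s\pi(s)\,\beta s/(1-s)>1$, that $s(1)\le\delta/(\beta+\delta)$, and that the first best violates the participation constraint of the young in the highest state: $\log c^*(s(I))+\beta\sum_r\pi(r)\log(1-c^*(r))<\hat\upsilon(s(I))$. Then the policies $f$ and $g_r$ are well defined on $\Omega(s)$ for every $s$ (a solution exists, the optimal $c$ is unique, and there are largest optimal promises), and: (i) $\omega^0(s)\in\Omega(s)$, and for every $\omega\in\Omega(s)$: $f(s,\omega)\in(0,s]$; $f(s,\omega)=1-\exp(\omega)$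 if $\omega\ge\omega^0(s)$; $f(s,\omega)=1-\exp(\omega^0(s))$ if $\omega<\omega^0(s)$. (ii) $c^0(s(i))\ge c^0(s(i-1))$ for $i=2,\dots,I$, with strict inequality for at least one $i$. (iii) For every $s$ the map $g_s(s,\cdot)$ has a smallest fixed point $\omega^f(s)$ in $\Omega(s)$; it equals $\min\{\omega^*(s),\omega_{\max}(s)\}$, and there is no other fixed point except possibly $\omega_{\max}(s)$. At this fixed point consumption is at least first best, $f(s,\omega^f(s))\ge c^*(s)$, with equality when $\omega^f(s)<\omega_{\max}(s)$. -/

import Mathlib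

open Finset

noncomputable section

/-- The primitives of the economy (consumption and endowments are measured as shares of the
aggregate endowment). There are `n + 2 ≥ 2` endowment states, ordered by the endowment share of the
young; states are drawn independently over time with the probabilities `prob`. -/
structure Economy (n : ℕ) where
  /-- endowment share of the young -/
  share : Fin (n + 2) → ℝ
  /-- probability of a state -/
  prob : Fin (n + 2) → ℝ
  /-- generational discount factor -/
  β : ℝ
  /-- the planner's discount factor -/
  δ : ℝ
  share_pos : ∀ s, 0 < share s
  share_lt_one : ∀ s, share s < 1
  share_strictMono : StrictMono share
  prob_pos : ∀ s, 0 < prob s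
  prob_sum : ∑ s, prob s = 1
  β_pos : 0 < β
  β_le_one : β ≤ 1
  δ_pos : 0 < δ
  δ_lt_one : δ < 1

/-- An intergenerational insurance rule: `c h s` is the consumption share of the young when the
past states are `h` (in chronological order) and the current state is `s`. -/
abbrev InsuranceRule (n : ℕ) : Type := List (Fin (n + 2)) → Fin (n + 2) → ℝ

namespace Economy

variable {n : ℕ} (E : Economy n)

/-- Lifetime utility of a young agent who consumes the own endowment in both periods of life. -/
def autarky (s : Fin (n + 2)) : ℝ :=
  Real.log (E.share s) + E.β * ∑ r, E.prob r * Real.log (1 - E.share r)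

/-- Lifetime utility under a rule of the agent born in state `s` after the past states `h`. -/
def lifetime (c : InsuranceRule n) (h : List (Fin (n + 2))) (s : Fin (n + 2)) : ℝ :=
  Real.log (c h s) + E.β * ∑ r, E.prob r * Real.log (1 - c (h ++ [s]) r)

/-- Sustainable rules: after every history neither the old nor the young prefer autarky. -/
structure Sustainable (c : InsuranceRule n) : Prop where
  pos : ∀ h s, 0 < c h s
  old : ∀ h s, c h s ≤ E.share s
  young : ∀ h s, E.autarky s ≤ E.lifetime c h s

/-- The planner's payoff within a period in which the young consume the share `x`. -/
def periodPayoff (x : ℝ) : ℝ := E.β / E.δ * Real.log (1 - x) + Real.log x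

/-- Expectation at date `0`, in the initial state `s`, of the planner's payoff within period `t`. -/
def expectedPayoff : ℕ → InsuranceRule n → Fin (n + 2) → ℝ
  | 0, c, s => E.periodPayoff (c [] s)
  | t + 1, c, s => ∑ r, E.prob r * expectedPayoff t (fun h => c (s :: h)) r

/-- The planner's expected discounted payoff from a rule, with initial state `s`. It differs from
the discounted sum of the expected utility gains over autarky of all generations (the initial old
having the weight `β / δ`) by a constant that does not depend on the rule. -/
def payoff (c : InsuranceRule n) (s : Fin (n + 2)) : ℝ :=
  ∑' t : ℕ, E.δ ^ t * E.expectedPayoff t c s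

/-- Utility of the old in autarky. -/
def ωmin (s : Fin (n + 2)) : ℝ := Real.log (1 - E.share s)

/-- The largest utility of the old in state `s` that a sustainable rule can deliver. -/
def ωmax (s : Fin (n + 2)) : ℝ :=
  sSup {x | ∃ c : InsuranceRule n, E.Sustainable c ∧ x = Real.log (1 - c [] s)}

/-- The set of feasible promises to the old in state `s`. -/
def promises (s : Fin (n + 2)) : Set ℝ := Set.Icc (E.ωmin s) (E.ωmax s)

/-- The planner's optimal value when the initial state is `s` and the initial old have to receive
at least the utility `ω`. -/
def value (s : Fin (n + 2)) (ω : ℝ) : ℝ :=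
  sSup {v | ∃ c : InsuranceRule n,
    E.Sustainable c ∧ ω ≤ Real.log (1 - c [] s) ∧ v = E.payoff c s}

/-- The constraint set of the recursive problem at the state `(s, ω)`; `x` is the consumption share
of the young and `w r` the utility promised for their old age if the next state is `r`. -/
structure Feasible (s : Fin (n + 2)) (ω x : ℝ) (w : Fin (n + 2) → ℝ) : Prop where
  pos : 0 < x
  keep : ω ≤ Real.log (1 - x)
  old : x ≤ E.share s
  upper : ∀ r, w r ≤ E.ωmax r
  lower : ∀ r, E.ωmin r ≤ w r
  young : E.autarky s ≤ Real.log x + E.β * ∑ r, E.prob r * w r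

/-- The objective of the recursive problem. -/
def objective (x : ℝ) (w : Fin (n + 2) → ℝ) : ℝ :=
  E.periodPayoff x + E.δ * ∑ r, E.prob r * E.value r (w r)

/-- `(x, w)` solves the recursive problem at `(s, ω)`. -/
def Solves (s : Fin (n + 2)) (ω x : ℝ) (w : Fin (n + 2) → ℝ) : Prop :=
  E.Feasible s ω x w ∧ ∀ y v, E.Feasible s ω y v → E.objective y v ≤ E.objective x w

/-- The optimal policy at `(s, ω)`. The value function is flat at low promises, so that optimal
promises need not be unique when the participation constraint of the young is slack; the policy
takes the largest ones. -/
def IsPolicy (s : Fin (n + 2)) (ω x : ℝ) (w : Fin (n + 2) → ℝ) : Prop :=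
  E.Solves s ω x w ∧ ∀ y v, E.Solves s ω y v → v ≤ w

/-- The optimal policy as a function of the state `(s, ω)`. -/
def policy (s : Fin (n + 2)) (ω : ℝ) : ℝ × (Fin (n + 2) → ℝ) :=
  Classical.epsilon fun p => E.IsPolicy s ω p.1 p.2

/-- Policy function for the consumption share of the young. -/
def f (s : Fin (n + 2)) (ω : ℝ) : ℝ := (E.policy s ω).1

/-- Policy function for the utility promised for next period's state `r`. -/
def g (r s : Fin (n + 2)) (ω : ℝ) : ℝ := (E.policy s ω).2 r

/-- The reset promise: the largest feasible promise that maximizes the planner's value. -/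
def ω0 (s : Fin (n + 2)) : ℝ :=
  sSup {ω | ω ∈ E.promises s ∧ ∀ x ∈ E.promises s, E.value s x ≤ E.value s ω}

/-- The reset consumption share of the young. -/
def c0 (s : Fin (n + 2)) : ℝ := E.f s (E.ω0 s)

/-- First-best consumption share of the young. -/
def cstar (s : Fin (n + 2)) : ℝ := min (E.δ / (E.β + E.δ)) (E.share s)

/-- First-best utility of the old. -/
def ωstar (s : Fin (n + 2)) : ℝ := max (E.ωmin s) (Real.log (E.β / (E.β + E.δ)))

/-- The feasible promises that are reproduced when the endowment state `s` repeats. -/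
def fixedPromises (s : Fin (n + 2)) : Set ℝ := {ω | ω ∈ E.promises s ∧ E.g s s ω = ω}

/-- The fixed point `ω^f(s)` of `g_s(s, ·)`: the smallest one (the upper end of the domain is
always a fixed point as well). -/
def ωf (s : Fin (n + 2)) : ℝ := sInf (E.fixedPromises s)

end Economy

end

noncomputable section

namespace Economy

variable {n : ℕ} (E : Economy n)

/-! ### Sustainable rules -/

/-! A sustainable rule can leave the young no less than a fixed fraction of their endowment. Leaving
exactly that fraction always is itself sustainable, so it is best for the old in every state at once
(`sustainable_minFraction`) and `ωmax` is explicit. All logarithms are thus bounded, the sustainable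
rules form a compact convex set, and the planner's payoff is continuous and concave on it. Hence
`value` is an attained maximum and concave, and gluing rules together gives the Bellman equation.

Strict concavity of the period payoff makes optimal consumption unique. So `value` is flat up to
`ω0`; beyond it the promise to the old binds, and `value` is strictly decreasing and strictly
concave. Promises raised to at least `ω0` remain optimal and are then unique, which gives the
largest policy and (i).

For (ii), if `c0` fell in the share, two states could exchange consumptions and mix promises without
loss, against uniqueness (`c0_mono_of_lt`). If `c0` were constant it would be the static optimum;
the highest state would then need a promise above `ω0`, and a small rise in consumption there costs
to second order but saves promises to first order (`exists_c0_lt`).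

For (iii), the promise is varied and the promise for the repeated state compensates (`first_order`).
At a fixed point below `ωmax` both variations see the same one-sided derivative of `value`, which
forces first-best consumption. Conversely, at `ωstar` the condition compares slopes of `value` at
the old and new promise, and strict concavity makes the two equal. At `ωmax` participation leaves no
slack, so every promise is maximal. -/

lemma one_sub_share_pos (s : Fin (n + 2)) : 0 < 1 - E.share s := by
  linarith [E.share_lt_one s]

variable {E} in
lemma Sustainable.lt_one {c : InsuranceRule n} (hc : E.Sustainable c) (h s) : c h s < 1 :=
  (hc.old h s).trans_lt (E.share_lt_one s)

/-- Expected utility gain over autarky of the old at the successors of the history `h`. -/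
def oldGain (c : InsuranceRule n) (h : List (Fin (n + 2))) : ℝ :=
  ∑ r, E.prob r * (Real.log (1 - c h r) - E.ωmin r)

lemma oldGain_eq (c : InsuranceRule n) (h : List (Fin (n + 2))) :
    E.oldGain c h
      = ∑ r, E.prob r * Real.log (1 - c h r) - ∑ r, E.prob r * Real.log (1 - E.share r) := by
  simp [oldGain, ωmin, mul_sub]

/-- The old-age autarky terms cancel: the loss of the young today is set against `β` times the next
old's gain, and the state matters only through its share. -/
lemma autarky_le_lifetime_iff (c : InsuranceRule n) (h : List (Fin (n + 2))) (s : Fin (n + 2)) :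
    E.autarky s ≤ E.lifetime c h s ↔
      Real.log (E.share s) ≤ Real.log (c h s) + E.β * E.oldGain c (h ++ [s]) := by
  rw [oldGain_eq, autarky, lifetime, mul_sub]
  constructor <;> intro H <;> linarith

lemma sustainable_share : E.Sustainable fun _ s => E.share s where
  pos _ s := E.share_pos s
  old _ _ := le_rfl
  young _ _ := le_rfl

variable {E} in
lemma Sustainable.continuation {c : InsuranceRule n} (hc : E.Sustainable c)
    (k : List (Fin (n + 2))) : E.Sustainable fun h => c (k ++ h) where
  pos h s := hc.pos _ s
  old h s := hc.old _ s
  young h s := by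
    have := hc.young (k ++ h) s
    simpa [lifetime, List.append_assoc] using this

/-- The largest expected utility gain over autarky of the old. -/
def maxGain : ℝ := sSup {x | ∃ c : InsuranceRule n, E.Sustainable c ∧ x = E.oldGain c []}

lemma bddAbove_gains :
    BddAbove {x | ∃ c : InsuranceRule n, E.Sustainable c ∧ x = E.oldGain c []} := by
  refine ⟨∑ r, E.prob r * (0 - E.ωmin r), ?_⟩
  rintro _ ⟨c, hc, rfl⟩
  refine sum_le_sum fun r _ => mul_le_mul_of_nonneg_left ?_ (E.prob_pos r).le
  have := Real.log_nonpos (x := 1 - c [] r) (by linarith [hc.lt_one [] r])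
    (by linarith [hc.pos [] r])
  linarith

variable {E} in
lemma Sustainable.oldGain_le {c : InsuranceRule n} (hc : E.Sustainable c)
    (h : List (Fin (n + 2))) : E.oldGain c h ≤ E.maxGain :=
  le_csSup E.bddAbove_gains ⟨_, hc.continuation h, by simp [oldGain]⟩

lemma maxGain_nonneg : 0 ≤ E.maxGain := by
  simpa [oldGain, ωmin] using E.sustainable_share.oldGain_le []

/-- The smallest fraction of their endowment that the young can be left with. -/
def minFraction : ℝ := Real.exp (-(E.β * E.maxGain))

lemma minFraction_pos : 0 < E.minFraction := Real.exp_pos _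

lemma minFraction_le_one : E.minFraction ≤ 1 :=
  Real.exp_le_one_iff.2 (neg_nonpos.2 (mul_nonneg E.β_pos.le E.maxGain_nonneg))

lemma minFraction_mul_pos (s : Fin (n + 2)) : 0 < E.minFraction * E.share s :=
  mul_pos E.minFraction_pos (E.share_pos s)

lemma minFraction_mul_le (s : Fin (n + 2)) : E.minFraction * E.share s ≤ E.share s :=
  mul_le_of_le_one_left (E.share_pos s).le E.minFraction_le_one

lemma log_minFraction_mul (s : Fin (n + 2)) :
    Real.log (E.minFraction * E.share s) = Real.log (E.share s) - E.β * E.maxGain := by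
  rw [Real.log_mul E.minFraction_pos.ne' (E.share_pos s).ne', minFraction, Real.log_exp]; ring

variable {E} in
lemma Sustainable.minFraction_mul_le {c : InsuranceRule n} (hc : E.Sustainable c) (h s) :
    E.minFraction * E.share s ≤ c h s := by
  rw [← Real.log_le_log_iff (E.minFraction_mul_pos s) (hc.pos h s), log_minFraction_mul]
  have h1 := (E.autarky_le_lifetime_iff c h s).1 (hc.young h s)
  have h2 := mul_le_mul_of_nonneg_left (hc.oldGain_le (h ++ [s])) E.β_pos.le
  linarith

/-- The bound closes on itself: consuming the lower bound gives the old at least the gain of any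
sustainable rule, hence at least `maxGain`, which is just what repays the young for consuming so
little. -/
lemma sustainable_minFraction : E.Sustainable fun _ s => E.minFraction * E.share s where
  pos _ s := E.minFraction_mul_pos s
  old _ s := E.minFraction_mul_le s
  young h s := by
    rw [autarky_le_lifetime_iff, log_minFraction_mul]
    have : E.maxGain ≤ E.oldGain (fun _ s => E.minFraction * E.share s) (h ++ [s]) := by
      refine csSup_le ⟨_, _, E.sustainable_share, rfl⟩ ?_
      rintro _ ⟨c, hc, rfl⟩
      refine sum_le_sum fun r _ => mul_le_mul_of_nonneg_left ?_ (E.prob_pos r).le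
      have := Real.log_le_log (x := 1 - c [] r) (y := 1 - E.minFraction * E.share r)
        (by linarith [hc.lt_one [] r]) (by linarith [hc.minFraction_mul_le [] r])
      linarith
    have := mul_le_mul_of_nonneg_left this E.β_pos.le
    linarith

lemma isGreatest_ωmax (s : Fin (n + 2)) :
    IsGreatest {x | ∃ c : InsuranceRule n, E.Sustainable c ∧ x = Real.log (1 - c [] s)}
      (Real.log (1 - E.minFraction * E.share s)) := by
  refine ⟨⟨_, E.sustainable_minFraction, rfl⟩, ?_⟩
  rintro _ ⟨c, hc, rfl⟩
  exact Real.log_le_log (by linarith [hc.lt_one [] s]) (by linarith [hc.minFraction_mul_le [] s])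

lemma ωmax_eq (s : Fin (n + 2)) : E.ωmax s = Real.log (1 - E.minFraction * E.share s) :=
  (E.isGreatest_ωmax s).csSup_eq

variable {E} in
lemma Sustainable.le_ωmax {c : InsuranceRule n} (hc : E.Sustainable c) (h s) :
    Real.log (1 - c h s) ≤ E.ωmax s := by
  rw [ωmax_eq]
  exact Real.log_le_log (by linarith [hc.lt_one h s]) (by linarith [hc.minFraction_mul_le h s])

variable {E} in
lemma Sustainable.ωmin_le {c : InsuranceRule n} (hc : E.Sustainable c) (h s) :
    E.ωmin s ≤ Real.log (1 - c h s) :=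
  Real.log_le_log (E.one_sub_share_pos s) (by linarith [hc.old h s])

lemma ωmin_le_ωmax (s : Fin (n + 2)) : E.ωmin s ≤ E.ωmax s :=
  E.sustainable_share.le_ωmax [] s

lemma maxGain_eq : E.maxGain = ∑ r, E.prob r * (E.ωmax r - E.ωmin r) := by
  refine le_antisymm ?_ ?_
  · refine csSup_le ⟨_, _, E.sustainable_share, rfl⟩ ?_
    rintro _ ⟨c, hc, rfl⟩
    exact sum_le_sum fun r _ => mul_le_mul_of_nonneg_left
      (sub_le_sub_right (hc.le_ωmax [] r) _) (E.prob_pos r).le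
  · simpa [oldGain, ωmax_eq] using E.sustainable_minFraction.oldGain_le []

/-! ### Compactness of the set of sustainable rules -/

/-- Rules that leave the young a fraction of their endowment between `minFraction` and `1`. -/
def box : Set (InsuranceRule n) :=
  Set.univ.pi fun _ => Set.univ.pi fun s => Set.Icc (E.minFraction * E.share s) (E.share s)

variable {E} in
lemma mem_box {c : InsuranceRule n} :
    c ∈ E.box ↔ ∀ h s, E.minFraction * E.share s ≤ c h s ∧ c h s ≤ E.share s := by
  simp only [box, Set.mem_pi, Set.mem_univ, true_imp_iff, Set.mem_Icc]

lemma isCompact_box : IsCompact E.box :=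
  isCompact_univ_pi fun _ => isCompact_univ_pi fun _ => isCompact_Icc

variable {E} in
lemma Sustainable.mem_box {c : InsuranceRule n} (hc : E.Sustainable c) : c ∈ E.box :=
  Economy.mem_box.2 fun h s => ⟨hc.minFraction_mul_le h s, hc.old h s⟩

lemma continuous_apply_apply (h : List (Fin (n + 2))) (s : Fin (n + 2)) :
    Continuous fun c : InsuranceRule n => c h s := by
  fun_prop

lemma continuousOn_log_apply (h : List (Fin (n + 2))) (s : Fin (n + 2)) :
    ContinuousOn (fun c : InsuranceRule n => Real.log (c h s)) E.box :=
  (continuous_apply_apply h s).continuousOn.log fun _ hc =>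
    ((E.minFraction_mul_pos s).trans_le (mem_box.1 hc h s).1).ne'

lemma continuousOn_log_one_sub_apply (h : List (Fin (n + 2))) (s : Fin (n + 2)) :
    ContinuousOn (fun c : InsuranceRule n => Real.log (1 - c h s)) E.box :=
  (continuous_const.sub (continuous_apply_apply h s)).continuousOn.log fun _ hc =>
    ((E.one_sub_share_pos s).trans_le (sub_le_sub_left (mem_box.1 hc h s).2 1)).ne'

lemma continuousOn_lifetime (h : List (Fin (n + 2))) (s : Fin (n + 2)) :
    ContinuousOn (fun c => E.lifetime c h s) E.box :=
  (E.continuousOn_log_apply h s).add <| continuousOn_const.mul <|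
    continuousOn_finsetSum _ fun r _ =>
      continuousOn_const.mul (E.continuousOn_log_one_sub_apply _ r)

/-- The box is compact by Tychonoff and keeps the arguments of the logarithms away from zero, so
each participation constraint is closed in it. -/
lemma isCompact_sustainable : IsCompact {c | E.Sustainable c} := by
  have hK := E.isCompact_box.isClosed
  have : {c | E.Sustainable c}
      = ⋂ h, ⋂ s, E.box ∩ (fun c => E.lifetime c h s) ⁻¹' Set.Ici (E.autarky s) := by
    ext c
    simp only [Set.mem_ofPred_eq, Set.mem_iInter, Set.mem_inter_iff, Set.mem_preimage, Set.mem_Ici]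
    refine ⟨fun hc h s => ⟨hc.mem_box, hc.young h s⟩, fun hc => ?_⟩
    have hb := mem_box.1 (hc [] 0).1
    exact ⟨fun h s => (E.minFraction_mul_pos s).trans_le (hb h s).1, fun h s => (hb h s).2,
      fun h s => (hc h s).2⟩
  refine E.isCompact_box.of_isClosed_subset ?_ fun c hc => hc.mem_box
  rw [this]
  exact isClosed_iInter fun h => isClosed_iInter fun s =>
    (E.continuousOn_lifetime h s).preimage_isClosed_of_isClosed hK isClosed_Ici

/-! ### The planner's payoff -/

/-- Uniformity in the date lets geometric discounting dominate the series, for summability and for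
continuity of the payoff. -/
lemma exists_payoff_bound : ∃ M, ∀ (t : ℕ) (c : InsuranceRule n) (s : Fin (n + 2)), c ∈ E.box →
    |E.expectedPayoff t c s| ≤ M := by
  have hcont : ∀ s, ContinuousOn E.periodPayoff
      (Set.Icc (E.minFraction * E.share s) (E.share s)) := fun s => by
    refine ContinuousOn.add (continuousOn_const.mul ?_) ?_
    · exact (continuous_const.sub continuous_id).continuousOn.log fun x hx =>
        ((E.one_sub_share_pos s).trans_le (sub_le_sub_left hx.2 1)).ne'
    · exact continuousOn_id.log fun x hx => ((E.minFraction_mul_pos s).trans_le hx.1).ne'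
  choose B hB using fun s => isCompact_Icc.exists_bound_of_continuousOn (hcont s)
  refine ⟨∑ s, |B s|, fun t => ?_⟩
  induction t with
  | zero =>
    intro c s hc
    refine (hB s _ (mem_box.1 hc [] s)).trans ((le_abs_self _).trans ?_)
    exact single_le_sum (f := fun s => |B s|) (fun _ _ => abs_nonneg _) (mem_univ s)
  | succ t ih =>
    intro c s hc
    have hc' : (fun h => c (s :: h)) ∈ E.box := mem_box.2 fun h r => mem_box.1 hc (s :: h) r
    calc |E.expectedPayoff (t + 1) c s|
        ≤ ∑ r, |E.prob r * E.expectedPayoff t (fun h => c (s :: h)) r| := abs_sum_le_sum_abs _ _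
      _ ≤ ∑ r, E.prob r * ∑ s, |B s| := by
          refine sum_le_sum fun r _ => ?_
          rw [abs_mul, abs_of_pos (E.prob_pos r)]
          exact mul_le_mul_of_nonneg_left (ih _ r hc') (E.prob_pos r).le
      _ = ∑ s, |B s| := by rw [← sum_mul, E.prob_sum, one_mul]

lemma summable_payoff {c : InsuranceRule n} (hc : c ∈ E.box) (s : Fin (n + 2)) :
    Summable fun t : ℕ => E.δ ^ t * E.expectedPayoff t c s := by
  obtain ⟨M, hM⟩ := E.exists_payoff_bound
  refine Summable.of_norm_bounded
    ((summable_geometric_of_lt_one E.δ_pos.le E.δ_lt_one).mul_right M) fun t => ?_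
  rw [Real.norm_eq_abs, abs_mul, abs_of_pos (pow_pos E.δ_pos t)]
  exact mul_le_mul_of_nonneg_left (hM t c s hc) (pow_pos E.δ_pos t).le

lemma continuousOn_expectedPayoff (t : ℕ) (s : Fin (n + 2)) (k : List (Fin (n + 2))) :
    ContinuousOn (fun c : InsuranceRule n => E.expectedPayoff t (fun h => c (k ++ h)) s)
      E.box := by
  induction t generalizing s k with
  | zero =>
    exact (continuousOn_const.mul (E.continuousOn_log_one_sub_apply _ s)).add
      (E.continuousOn_log_apply _ s)
  | succ t ih =>
    refine continuousOn_finsetSum _ fun r _ => continuousOn_const.mul ?_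
    simpa using ih r (k ++ [s])

lemma continuousOn_payoff (s : Fin (n + 2)) :
    ContinuousOn (fun c => E.payoff c s) E.box := by
  obtain ⟨M, hM⟩ := E.exists_payoff_bound
  refine continuousOn_tsum
    (fun t => continuousOn_const.mul (E.continuousOn_expectedPayoff t s []))
    ((summable_geometric_of_lt_one E.δ_pos.le E.δ_lt_one).mul_right M) fun t c hc => ?_
  rw [Real.norm_eq_abs, abs_mul, abs_of_pos (pow_pos E.δ_pos t)]
  exact mul_le_mul_of_nonneg_left (hM t c s hc) (pow_pos E.δ_pos t).le

lemma payoff_eq {c : InsuranceRule n} (hc : c ∈ E.box) (s : Fin (n + 2)) :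
    E.payoff c s = E.periodPayoff (c [] s)
      + E.δ * ∑ r, E.prob r * E.payoff (fun h => c (s :: h)) r := by
  have hc' : (fun h => c (s :: h)) ∈ E.box := mem_box.2 fun h r => mem_box.1 hc (s :: h) r
  rw [payoff, (E.summable_payoff hc s).tsum_eq_zero_add]
  congr 1
  · simp [expectedPayoff]
  · simp only [payoff, ← tsum_mul_left]
    rw [← Summable.tsum_finsetSum fun r _ => (E.summable_payoff hc' r).mul_left _,
      ← tsum_mul_left]
    refine tsum_congr fun t => ?_
    simp only [expectedPayoff, mul_sum]
    exact sum_congr rfl fun r _ => by ring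

lemma strictConcaveOn_periodPayoff : StrictConcaveOn ℝ (Set.Ioo 0 1) E.periodPayoff := by
  refine ConcaveOn.add_strictConcaveOn ?_
    (strictConcaveOn_log_Ioi.subset (fun x hx => hx.1) (convex_Ioo 0 1))
  have h1 : ConcaveOn ℝ (Set.Ioo (0 : ℝ) 1) fun x => Real.log (1 - x) := by
    refine ⟨convex_Ioo 0 1, fun x hx y hy a b ha hb hab => ?_⟩
    have := strictConcaveOn_log_Ioi.concaveOn.2 (x := 1 - x) (y := 1 - y)
      (by simpa using hx.2) (by simpa using hy.2) ha hb hab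
    refine this.trans_eq (congrArg Real.log ?_)
    simp only [smul_eq_mul]; linear_combination hab
  exact h1.smul (div_pos E.β_pos E.δ_pos).le

lemma log_mix_le {x y a b : ℝ} (hx : 0 < x) (hy : 0 < y) (ha : 0 ≤ a) (hb : 0 ≤ b)
    (hab : a + b = 1) : a * Real.log x + b * Real.log y ≤ Real.log (a * x + b * y) := by
  simpa using strictConcaveOn_log_Ioi.concaveOn.2 (x := x) (y := y) hx hy ha hb hab

lemma log_one_sub_mix_le {x y a b : ℝ} (hx : x < 1) (hy : y < 1) (ha : 0 ≤ a) (hb : 0 ≤ b)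
    (hab : a + b = 1) :
    a * Real.log (1 - x) + b * Real.log (1 - y) ≤ Real.log (1 - (a * x + b * y)) := by
  refine (log_mix_le (sub_pos.2 hx) (sub_pos.2 hy) ha hb hab).trans_eq (congrArg Real.log ?_)
  linear_combination hab

/-- Pointwise convex combination of two rules. -/
def mix (a b : ℝ) (c d : InsuranceRule n) : InsuranceRule n := fun h s => a * c h s + b * d h s

variable {E} in
lemma Sustainable.mix {c d : InsuranceRule n} (hc : E.Sustainable c) (hd : E.Sustainable d)
    {a b : ℝ} (ha : 0 < a) (hb : 0 < b) (hab : a + b = 1) : E.Sustainable (mix a b c d) where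
  pos h s := add_pos (mul_pos ha (hc.pos h s)) (mul_pos hb (hd.pos h s))
  old h s := by
    have h1 := mul_le_mul_of_nonneg_left (hc.old h s) ha.le
    have h2 := mul_le_mul_of_nonneg_left (hd.old h s) hb.le
    calc a * c h s + b * d h s ≤ (a + b) * E.share s := by linarith
      _ = E.share s := by rw [hab, one_mul]
  young h s := by
    have h1 := log_mix_le (hc.pos h s) (hd.pos h s) ha.le hb.le hab
    have h2 : a * ∑ r, E.prob r * Real.log (1 - c (h ++ [s]) r)
        + b * ∑ r, E.prob r * Real.log (1 - d (h ++ [s]) r)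
        ≤ ∑ r, E.prob r * Real.log (1 - Economy.mix a b c d (h ++ [s]) r) := by
      rw [mul_sum, mul_sum, ← sum_add_distrib]
      refine sum_le_sum fun r _ => ?_
      have := mul_le_mul_of_nonneg_left
        (log_one_sub_mix_le (hc.lt_one (h ++ [s]) r) (hd.lt_one (h ++ [s]) r) ha.le hb.le hab)
        (E.prob_pos r).le
      exact le_trans (le_of_eq (by ring)) this
    have h3 := mul_le_mul_of_nonneg_left (hc.young h s) ha.le
    have h4 := mul_le_mul_of_nonneg_left (hd.young h s) hb.le
    have h5 := mul_le_mul_of_nonneg_left h2 E.β_pos.le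
    have h6 : E.autarky s = a * E.autarky s + b * E.autarky s := by rw [← add_mul, hab, one_mul]
    have h7 : Real.log (Economy.mix a b c d h s) = Real.log (a * c h s + b * d h s) := rfl
    simp only [lifetime] at *
    rw [h6, h7]
    linarith

lemma expectedPayoff_mix (t : ℕ) {c d : InsuranceRule n} (hc : c ∈ E.box) (hd : d ∈ E.box)
    {a b : ℝ} (ha : 0 < a) (hb : 0 < b) (hab : a + b = 1) (s : Fin (n + 2)) :
    a * E.expectedPayoff t c s + b * E.expectedPayoff t d s
      ≤ E.expectedPayoff t (mix a b c d) s := by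
  induction t generalizing c d s with
  | zero =>
    have hm : ∀ {c : InsuranceRule n}, c ∈ E.box → c [] s ∈ Set.Ioo (0 : ℝ) 1 := fun h =>
      ⟨(E.minFraction_mul_pos s).trans_le (mem_box.1 h [] s).1,
        (mem_box.1 h [] s).2.trans_lt (E.share_lt_one s)⟩
    exact E.strictConcaveOn_periodPayoff.concaveOn.2 (hm hc) (hm hd) ha.le hb.le hab
  | succ t ih =>
    simp only [expectedPayoff]
    rw [mul_sum, mul_sum, ← sum_add_distrib]
    refine sum_le_sum fun r _ => ?_
    have := mul_le_mul_of_nonneg_left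
      (ih (c := fun h => c (s :: h)) (d := fun h => d (s :: h))
        (mem_box.2 fun h r => mem_box.1 hc (s :: h) r)
        (mem_box.2 fun h r => mem_box.1 hd (s :: h) r) r) (E.prob_pos r).le
    exact le_trans (le_of_eq (by ring)) this

lemma payoff_mix {c d : InsuranceRule n} (hc : E.Sustainable c) (hd : E.Sustainable d)
    {a b : ℝ} (ha : 0 < a) (hb : 0 < b) (hab : a + b = 1) (s : Fin (n + 2)) :
    a * E.payoff c s + b * E.payoff d s ≤ E.payoff (mix a b c d) s := by
  have h1 := (E.summable_payoff hc.mem_box s).mul_left a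
  have h2 := (E.summable_payoff hd.mem_box s).mul_left b
  rw [payoff, payoff, ← tsum_mul_left, ← tsum_mul_left, ← h1.tsum_add h2]
  refine (h1.add h2).tsum_le_tsum (fun t => ?_)
    (E.summable_payoff (hc.mix hd ha hb hab).mem_box s)
  have := mul_le_mul_of_nonneg_left (E.expectedPayoff_mix t hc.mem_box hd.mem_box ha hb hab s)
    (pow_pos E.δ_pos t).le
  exact le_trans (le_of_eq (by ring)) this

/-! ### The value function -/

/-- Weierstrass on the compact set of sustainable rules; the constraint set is nonempty because the
minimal-fraction rule delivers `ωmax`. -/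
lemma exists_optimal_rule {s : Fin (n + 2)} {ω : ℝ} (hω : ω ≤ E.ωmax s) :
    ∃ c, E.Sustainable c ∧ ω ≤ Real.log (1 - c [] s) ∧ E.payoff c s = E.value s ω ∧
      ∀ d, E.Sustainable d → ω ≤ Real.log (1 - d [] s) → E.payoff d s ≤ E.value s ω := by
  have hS := E.isCompact_sustainable
  have hsub : {c | E.Sustainable c} ⊆ E.box := fun c hc => hc.mem_box
  have hcl := ((E.continuousOn_log_one_sub_apply [] s).mono hsub).preimage_isClosed_of_isClosed
    hS.isClosed (isClosed_Ici (a := ω))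
  have hK := hS.of_isClosed_subset hcl Set.inter_subset_left
  obtain ⟨c, hc, hmax⟩ := hK.exists_isMaxOn
    ⟨_, E.sustainable_minFraction, by simpa [← ωmax_eq] using hω⟩
    ((E.continuousOn_payoff s).mono (Set.inter_subset_left.trans hsub))
  have hg : IsGreatest {v | ∃ c : InsuranceRule n,
      E.Sustainable c ∧ ω ≤ Real.log (1 - c [] s) ∧ v = E.payoff c s} (E.payoff c s) := by
    refine ⟨⟨c, hc.1, hc.2, rfl⟩, ?_⟩
    rintro _ ⟨d, hd, hd', rfl⟩
    exact hmax ⟨hd, hd'⟩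
  have hv : E.value s ω = E.payoff c s := hg.csSup_eq
  exact ⟨c, hc.1, hc.2, hv.symm, fun d hd hd' => hv ▸ hmax ⟨hd, hd'⟩⟩

variable {E} in
lemma Sustainable.payoff_le_value {c : InsuranceRule n} (hc : E.Sustainable c)
    {s : Fin (n + 2)} {ω : ℝ} (hω : ω ≤ Real.log (1 - c [] s)) : E.payoff c s ≤ E.value s ω := by
  obtain ⟨_, _, _, _, h⟩ := E.exists_optimal_rule (hω.trans (hc.le_ωmax [] s))
  exact h c hc hω

lemma value_anti {s : Fin (n + 2)} {ω ω' : ℝ} (h : ω ≤ ω') (hω' : ω' ≤ E.ωmax s) :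
    E.value s ω' ≤ E.value s ω := by
  obtain ⟨c, hc, hc', he, -⟩ := E.exists_optimal_rule hω'
  exact he ▸ hc.payoff_le_value (h.trans hc')

/-- The domain is not cut off at `ωmin`, so `ωmin` is interior whenever it lies below `ωmax`;
one-sided derivatives there use this. -/
lemma concaveOn_value (s : Fin (n + 2)) : ConcaveOn ℝ (Set.Iic (E.ωmax s)) (E.value s) := by
  refine concaveOn_iff_forall_pos.2 ⟨convex_Iic _, fun ω hω ω' hω' a b ha hb hab => ?_⟩
  obtain ⟨c, hc, hc', he, -⟩ := E.exists_optimal_rule (Set.mem_Iic.1 hω)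
  obtain ⟨d, hd, hd', he', -⟩ := E.exists_optimal_rule (Set.mem_Iic.1 hω')
  rw [← he, ← he']
  refine (E.payoff_mix hc hd ha hb hab s).trans ((hc.mix hd ha hb hab).payoff_le_value ?_)
  refine le_trans ?_ (log_one_sub_mix_le (hc.lt_one [] s) (hd.lt_one [] s) ha.le hb.le hab)
  simp only [smul_eq_mul]
  gcongr

/-! ### Composition of rules and the Bellman equation -/

/-- The rule that follows `d r` if the initial state is `r`. -/
def merge (d : Fin (n + 2) → InsuranceRule n) : InsuranceRule n
  | [], r => d r [] r
  | r :: h, s => d r (r :: h) s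

/-- The rule with initial consumption `x` in state `s` followed by `m`, and with autarky if the
initial state is not `s`. -/
def prepend (s : Fin (n + 2)) (x : ℝ) (m : InsuranceRule n) : InsuranceRule n
  | [], r => if r = s then x else E.share r
  | a :: h, r => if a = s then m h r else E.share r

variable {E} in
lemma Sustainable.merge {d : Fin (n + 2) → InsuranceRule n} (hd : ∀ r, E.Sustainable (d r)) :
    E.Sustainable (merge d) where
  pos h s := by cases h <;> exact (hd _).pos _ _
  old h s := by cases h <;> exact (hd _).old _ _
  young h s := by cases h <;> exact (hd _).young _ _

variable {E} in
lemma Sustainable.prepend {m : InsuranceRule n} (hm : E.Sustainable m) {s : Fin (n + 2)} {x : ℝ}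
    (hx : 0 < x) (hxs : x ≤ E.share s)
    (hy : E.autarky s ≤ Real.log x + E.β * ∑ r, E.prob r * Real.log (1 - m [] r)) :
    E.Sustainable (E.prepend s x m) where
  pos h r := by
    rcases h with - | ⟨a, h⟩ <;> simp only [Economy.prepend] <;> split_ifs
    exacts [hx, E.share_pos r, hm.pos h r, E.share_pos r]
  old h r := by
    rcases h with - | ⟨a, h⟩ <;> simp only [Economy.prepend] <;> split_ifs with e
    exacts [e ▸ hxs, le_rfl, hm.old h r, le_rfl]
  young h r := by
    rcases h with - | ⟨a, h⟩ <;> simp only [Economy.prepend, lifetime, List.nil_append,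
      List.cons_append] <;> split_ifs with e
    exacts [e ▸ hy, le_rfl, hm.young h r, le_rfl]

lemma payoff_merge (d : Fin (n + 2) → InsuranceRule n) (r : Fin (n + 2)) :
    E.payoff (merge d) r = E.payoff (d r) r := by
  refine tsum_congr fun t => ?_
  cases t <;> rfl

variable {E} in
lemma Sustainable.payoff_prepend {m : InsuranceRule n} {s : Fin (n + 2)} {x : ℝ}
    (h : E.Sustainable (E.prepend s x m)) :
    E.payoff (E.prepend s x m) s
      = E.periodPayoff x + E.δ * ∑ r, E.prob r * E.payoff m r := by
  rw [E.payoff_eq h.mem_box]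
  have : (fun k => E.prepend s x m (s :: k)) = m := by
    funext k r; simp [Economy.prepend]
  rw [this]
  simp [Economy.prepend]

variable {E} in
-- Optimal continuations deliver at least the promised utilities, so gluing them together can only
-- relax the participation constraint of the young.
lemma Feasible.exists_rule {s : Fin (n + 2)} {ω x : ℝ} {w : Fin (n + 2) → ℝ}
    (h : E.Feasible s ω x w) :
    ∃ m, E.Sustainable (E.prepend s x m) ∧ ∀ r, E.payoff m r = E.value r (w r) := by
  choose d hd hd' he _ using fun r => E.exists_optimal_rule (h.upper r)
  refine ⟨merge d, (Sustainable.merge hd).prepend h.pos h.old (h.young.trans ?_),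
    fun r => (E.payoff_merge d r).trans (he r)⟩
  gcongr with r
  · exact E.β_pos.le
  · exact (E.prob_pos r).le
  · exact hd' r

variable {E} in
lemma Feasible.objective_le_value {s : Fin (n + 2)} {ω x : ℝ} {w : Fin (n + 2) → ℝ}
    (h : E.Feasible s ω x w) : E.objective x w ≤ E.value s ω := by
  obtain ⟨m, hm, he⟩ := h.exists_rule
  have := hm.payoff_le_value (s := s) (ω := ω) (by simpa [prepend] using h.keep)
  rw [hm.payoff_prepend] at this
  simpa only [objective, he] using this

/-- An optimal rule is split into its first consumption and its continuations; the utilities it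
delivers serve as promises, and no continuation beats `value` at them. -/
lemma exists_feasible_objective_eq {s : Fin (n + 2)} {ω : ℝ} (hω : ω ≤ E.ωmax s) :
    ∃ x w, E.Feasible s ω x w ∧ E.objective x w = E.value s ω := by
  obtain ⟨c, hc, hc', he, -⟩ := E.exists_optimal_rule hω
  have hf : E.Feasible s ω (c [] s) fun r => Real.log (1 - c [s] r) :=
    ⟨hc.pos _ _, hc', hc.old _ _, fun r => hc.le_ωmax _ r, fun r => hc.ωmin_le _ r,
      hc.young [] s⟩
  refine ⟨_, _, hf, le_antisymm hf.objective_le_value ?_⟩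
  rw [← he, E.payoff_eq hc.mem_box, objective]
  gcongr with r
  · exact E.δ_pos.le
  · exact (E.prob_pos r).le
  · exact (hc.continuation [s]).payoff_le_value le_rfl

lemma exists_solves {s : Fin (n + 2)} {ω : ℝ} (hω : ω ≤ E.ωmax s) : ∃ x w, E.Solves s ω x w := by
  obtain ⟨x, w, hf, he⟩ := E.exists_feasible_objective_eq hω
  exact ⟨x, w, hf, fun y v h => he ▸ h.objective_le_value⟩

variable {E} in
lemma Feasible.lt_one {s : Fin (n + 2)} {ω x : ℝ} {w : Fin (n + 2) → ℝ}
    (h : E.Feasible s ω x w) : x < 1 := h.old.trans_lt (E.share_lt_one s)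

variable {E} in
lemma Feasible.exp_le {s : Fin (n + 2)} {ω x : ℝ} {w : Fin (n + 2) → ℝ}
    (h : E.Feasible s ω x w) : Real.exp ω ≤ 1 - x :=
  (Real.le_log_iff_exp_le (sub_pos.2 h.lt_one)).1 h.keep

variable {E} in
lemma Feasible.of_le {s : Fin (n + 2)} {ω ω' x : ℝ} {w : Fin (n + 2) → ℝ}
    (h : E.Feasible s ω x w) (hω : ω' ≤ Real.log (1 - x)) : E.Feasible s ω' x w :=
  ⟨h.pos, hω, h.old, h.upper, h.lower, h.young⟩

variable {E} in
lemma Feasible.sup {s : Fin (n + 2)} {ω x : ℝ} {w v : Fin (n + 2) → ℝ}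
    (h : E.Feasible s ω x w) (hv : ∀ r, v r ≤ E.ωmax r) : E.Feasible s ω x (w ⊔ v) := by
  refine ⟨h.pos, h.keep, h.old, fun r => sup_le (h.upper r) (hv r),
    fun r => (h.lower r).trans le_sup_left, h.young.trans ?_⟩
  gcongr with r
  · exact E.β_pos.le
  · exact (E.prob_pos r).le
  · exact le_sup_left

variable {E} in
lemma Feasible.minFraction_mul_le {s : Fin (n + 2)} {ω x : ℝ} {w : Fin (n + 2) → ℝ}
    (h : E.Feasible s ω x w) : E.minFraction * E.share s ≤ x := by
  obtain ⟨m, hm, -⟩ := h.exists_rule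
  simpa [prepend] using hm.minFraction_mul_le [] s

variable {E} in
lemma Feasible.le_ωmax {s : Fin (n + 2)} {ω x : ℝ} {w : Fin (n + 2) → ℝ}
    (h : E.Feasible s ω x w) : ω ≤ E.ωmax s := by
  rw [ωmax_eq]
  exact h.keep.trans (Real.log_le_log (sub_pos.2 h.lt_one)
    (by linarith [h.minFraction_mul_le]))

variable {E} in
lemma Solves.objective_eq {s : Fin (n + 2)} {ω x : ℝ} {w : Fin (n + 2) → ℝ}
    (h : E.Solves s ω x w) : E.objective x w = E.value s ω := by
  obtain ⟨y, v, hf, he⟩ := E.exists_feasible_objective_eq h.1.le_ωmax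
  exact le_antisymm h.1.objective_le_value (he ▸ h.2 y v hf)

variable {E} in
lemma Feasible.solves {s : Fin (n + 2)} {ω x : ℝ} {w : Fin (n + 2) → ℝ}
    (h : E.Feasible s ω x w) (hv : E.value s ω ≤ E.objective x w) : E.Solves s ω x w :=
  ⟨h, fun _ _ h' => h'.objective_le_value.trans hv⟩

/-! ### Convexity of the recursive problem -/

variable {E} in
lemma Feasible.mix {s : Fin (n + 2)} {ω ω' x x' : ℝ} {w w' : Fin (n + 2) → ℝ}
    (h : E.Feasible s ω x w) (h' : E.Feasible s ω' x' w') {a b : ℝ} (ha : 0 < a) (hb : 0 < b)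
    (hab : a + b = 1) : E.Feasible s (a * ω + b * ω') (a * x + b * x') (a • w + b • w') where
  pos := add_pos (mul_pos ha h.pos) (mul_pos hb h'.pos)
  keep := by
    refine le_trans ?_ (log_one_sub_mix_le h.lt_one h'.lt_one ha.le hb.le hab)
    have := mul_le_mul_of_nonneg_left h.keep ha.le
    have := mul_le_mul_of_nonneg_left h'.keep hb.le
    linarith
  old := by
    have h1 := mul_le_mul_of_nonneg_left h.old ha.le
    have h2 := mul_le_mul_of_nonneg_left h'.old hb.le
    linear_combination h1 + h2 + E.share s * hab
  upper r := by
    have h1 := mul_le_mul_of_nonneg_left (h.upper r) ha.le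
    have h2 := mul_le_mul_of_nonneg_left (h'.upper r) hb.le
    simp only [Pi.add_apply, Pi.smul_apply, smul_eq_mul]
    linear_combination h1 + h2 + E.ωmax r * hab
  lower r := by
    have h1 := mul_le_mul_of_nonneg_left (h.lower r) ha.le
    have h2 := mul_le_mul_of_nonneg_left (h'.lower r) hb.le
    simp only [Pi.add_apply, Pi.smul_apply, smul_eq_mul]
    linear_combination h1 + h2 - E.ωmin r * hab
  young := by
    have h1 := mul_le_mul_of_nonneg_left h.young ha.le
    have h2 := mul_le_mul_of_nonneg_left h'.young hb.le
    have h3 := log_mix_le h.pos h'.pos ha.le hb.le hab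
    have h4 : ∑ r, E.prob r * (a • w + b • w') r
        = a * ∑ r, E.prob r * w r + b * ∑ r, E.prob r * w' r := by
      rw [mul_sum, mul_sum, ← sum_add_distrib]
      exact sum_congr rfl fun r _ => by simp; ring
    rw [h4]
    linear_combination h1 + h2 + h3 - E.autarky s * hab

lemma value_mix {s : Fin (n + 2)} {ω ω' : ℝ} (hω : ω ≤ E.ωmax s) (hω' : ω' ≤ E.ωmax s)
    {a b : ℝ} (ha : 0 < a) (hb : 0 < b) (hab : a + b = 1) :
    a * E.value s ω + b * E.value s ω' ≤ E.value s (a * ω + b * ω') :=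
  (E.concaveOn_value s).2 hω hω' ha.le hb.le hab

lemma sum_value_mix {w w' : Fin (n + 2) → ℝ} (h : ∀ r, w r ≤ E.ωmax r)
    (h' : ∀ r, w' r ≤ E.ωmax r) {a b : ℝ} (ha : 0 < a) (hb : 0 < b) (hab : a + b = 1) :
    a * ∑ r, E.prob r * E.value r (w r) + b * ∑ r, E.prob r * E.value r (w' r)
      ≤ ∑ r, E.prob r * E.value r ((a • w + b • w') r) := by
  rw [mul_sum, mul_sum, ← sum_add_distrib]
  refine sum_le_sum fun r _ => ?_
  have := mul_le_mul_of_nonneg_left (E.value_mix (h r) (h' r) ha hb hab) (E.prob_pos r).le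
  exact le_trans (le_of_eq (by ring)) this

lemma objective_mix_lt {x x' : ℝ} {w w' : Fin (n + 2) → ℝ} (hx : x ∈ Set.Ioo (0 : ℝ) 1)
    (hx' : x' ∈ Set.Ioo (0 : ℝ) 1) (hne : x ≠ x') (h : ∀ r, w r ≤ E.ωmax r)
    (h' : ∀ r, w' r ≤ E.ωmax r) {a b : ℝ} (ha : 0 < a) (hb : 0 < b) (hab : a + b = 1) :
    a * E.objective x w + b * E.objective x' w'
      < E.objective (a * x + b * x') (a • w + b • w') := by
  have h1 := E.strictConcaveOn_periodPayoff.2 hx hx' hne ha hb hab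
  have h2 := mul_le_mul_of_nonneg_left (E.sum_value_mix h h' ha hb hab) E.δ_pos.le
  simp only [smul_eq_mul] at h1
  simp only [objective]
  linarith

variable {E} in
lemma Solves.unique {s : Fin (n + 2)} {ω x x' : ℝ} {w w' : Fin (n + 2) → ℝ}
    (h : E.Solves s ω x w) (h' : E.Solves s ω x' w') : x = x' := by
  by_contra hne
  have hab : (1 / 2 : ℝ) + 1 / 2 = 1 := by norm_num
  have hf := h.1.mix h'.1 one_half_pos one_half_pos hab
  rw [← add_mul, hab, one_mul] at hf
  have hlt := E.objective_mix_lt ⟨h.1.pos, h.1.lt_one⟩ ⟨h'.1.pos, h'.1.lt_one⟩ hne h.1.upper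
    h'.1.upper one_half_pos one_half_pos hab
  have := h.2 _ _ hf
  have := h'.2 _ _ hf
  linarith

/-! ### The reset promise -/

variable {E} in
-- Here `x` is the optimum when the promise to the old is vacuous. A promise costs nothing exactly
-- when `x` honours it, since an equally good choice must have the same consumption.
lemma Solves.value_eq_iff {s : Fin (n + 2)} {x : ℝ} {w : Fin (n + 2) → ℝ}
    (h : E.Solves s (E.ωmin s) x w) {ω : ℝ} (hω : E.ωmin s ≤ ω) (hω' : ω ≤ E.ωmax s) :
    E.value s ω = E.value s (E.ωmin s) ↔ ω ≤ Real.log (1 - x) := by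
  constructor
  · intro he
    obtain ⟨y, v, hf, hy⟩ := E.exists_feasible_objective_eq hω'
    have hs : E.Solves s (E.ωmin s) y v := (hf.of_le (hω.trans hf.keep)).solves (he ▸ hy.ge)
    exact h.unique hs ▸ hf.keep
  · intro hle
    refine le_antisymm (E.value_anti hω hω') ?_
    exact h.objective_eq ▸ (h.1.of_le hle).objective_le_value

variable {E} in
lemma Solves.ω0_eq {s : Fin (n + 2)} {x : ℝ} {w : Fin (n + 2) → ℝ}
    (h : E.Solves s (E.ωmin s) x w) : E.ω0 s = Real.log (1 - x) := by
  have hmax := (h.1.of_le le_rfl).le_ωmax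
  refine IsGreatest.csSup_eq ⟨⟨⟨h.1.keep, hmax⟩, fun y hy => ?_⟩, fun ω hω => ?_⟩
  · rw [(h.value_eq_iff h.1.keep hmax).2 le_rfl]
    exact E.value_anti hy.1 hy.2
  · refine (h.value_eq_iff hω.1.1 hω.1.2).1 (le_antisymm (E.value_anti hω.1.1 hω.1.2) ?_)
    exact hω.2 _ ⟨le_rfl, E.ωmin_le_ωmax s⟩

lemma ω0_mem (s : Fin (n + 2)) : E.ω0 s ∈ E.promises s := by
  obtain ⟨x, w, h⟩ := E.exists_solves (E.ωmin_le_ωmax s)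
  rw [h.ω0_eq]
  exact ⟨h.1.keep, (h.1.of_le le_rfl).le_ωmax⟩

lemma value_eq_of_le_ω0 {s : Fin (n + 2)} {ω : ℝ} (hω : E.ωmin s ≤ ω) (h0 : ω ≤ E.ω0 s) :
    E.value s ω = E.value s (E.ωmin s) := by
  obtain ⟨x, w, h⟩ := E.exists_solves (E.ωmin_le_ωmax s)
  rw [h.value_eq_iff hω (h0.trans (E.ω0_mem s).2)]
  exact h.ω0_eq ▸ h0

lemma value_lt_of_ω0_lt {s : Fin (n + 2)} {ω : ℝ} (h0 : E.ω0 s < ω) (hω : ω ≤ E.ωmax s) :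
    E.value s ω < E.value s (E.ω0 s) := by
  obtain ⟨x, w, h⟩ := E.exists_solves (E.ωmin_le_ωmax s)
  have hmin := (E.ω0_mem s).1
  rw [E.value_eq_of_le_ω0 hmin le_rfl]
  refine lt_of_le_of_ne (E.value_anti (hmin.trans h0.le) hω) fun he => ?_
  have := (h.value_eq_iff (hmin.trans h0.le) hω).1 he
  rw [← h.ω0_eq] at this
  linarith

variable {E} in
lemma Solves.of_le_ω0 {s : Fin (n + 2)} {ω x : ℝ} {w : Fin (n + 2) → ℝ}
    (h : E.Solves s ω x w) (hω : E.ωmin s ≤ ω) (h0 : ω ≤ E.ω0 s) :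
    x = 1 - Real.exp (E.ω0 s) := by
  obtain ⟨x0, w0, h'⟩ := E.exists_solves (E.ωmin_le_ωmax s)
  have hs : E.Solves s (E.ωmin s) x w :=
    (h.1.of_le (hω.trans h.1.keep)).solves (by rw [h.objective_eq, E.value_eq_of_le_ω0 hω h0])
  rw [hs.ω0_eq, Real.exp_log (sub_pos.2 hs.1.lt_one)]
  ring

variable {E} in
lemma Solves.of_ω0_le {s : Fin (n + 2)} {ω x : ℝ} {w : Fin (n + 2) → ℝ}
    (h : E.Solves s ω x w) (h0 : E.ω0 s ≤ ω) : x = 1 - Real.exp ω := by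
  rcases h0.eq_or_lt with rfl | h0
  · exact h.of_le_ω0 (E.ω0_mem s).1 le_rfl
  obtain ⟨x0, w0, h'⟩ := E.exists_solves (E.ωmin_le_ωmax s)
  by_contra hne
  have hlt : x < 1 - Real.exp ω :=
    lt_of_le_of_ne (by linarith [h.1.exp_le]) hne
  have hx0 : 1 - Real.exp ω < x0 := by
    have := Real.exp_lt_exp.2 h0
    rw [h'.ω0_eq, Real.exp_log (sub_pos.2 h'.1.lt_one)] at this
    linarith
  -- If the promise were slack, consumption could move towards the unconstrained optimum `x0` until
  -- it binds. The weights hit that point, and strict concavity makes the mixture better.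
  obtain ⟨a, b, ha, hb, hab, hm⟩ : ∃ a b : ℝ, 0 < a ∧ 0 < b ∧ a + b = 1 ∧
      a * x + b * x0 = 1 - Real.exp ω := by
    refine ⟨(x0 - (1 - Real.exp ω)) / (x0 - x), ((1 - Real.exp ω) - x) / (x0 - x),
      div_pos (by linarith) (by linarith), div_pos (by linarith) (by linarith), ?_, ?_⟩
    all_goals
      have : x0 - x ≠ 0 := by linarith
      field_simp
      ring
  have hmin := (E.ω0_mem s).1
  have hf0 : E.Feasible s (E.ωmin s) x w := h.1.of_le ((hmin.trans h0.le).trans h.1.keep)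
  have hf : E.Feasible s ω (a * x + b * x0) (a • w + b • w0) :=
    (hf0.mix h'.1 ha hb hab).of_le (by rw [hm]; simp)
  have h1 := E.objective_mix_lt ⟨h.1.pos, h.1.lt_one⟩ ⟨h'.1.pos, h'.1.lt_one⟩
    (by linarith : x < x0).ne h.1.upper h'.1.upper ha hb hab
  have h2 := h.2 _ _ hf
  have h3 := mul_le_mul_of_nonneg_left (h'.2 _ _ hf0) hb.le
  have h4 : E.objective x w = a * E.objective x w + b * E.objective x w := by
    rw [← add_mul, hab, one_mul]
  linarith

/-- Strict concavity of the value function above the reset promise. -/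
lemma value_mix_lt {s : Fin (n + 2)} {ω ω' : ℝ} (hω0 : E.ω0 s ≤ ω) (hω0' : E.ω0 s ≤ ω')
    (hω : ω ≤ E.ωmax s) (hω' : ω' ≤ E.ωmax s) (hne : ω ≠ ω')
    {a b : ℝ} (ha : 0 < a) (hb : 0 < b) (hab : a + b = 1) :
    a * E.value s ω + b * E.value s ω' < E.value s (a * ω + b * ω') := by
  obtain ⟨x, w, h⟩ := E.exists_solves hω
  obtain ⟨x', w', h'⟩ := E.exists_solves hω'
  have hx := h.of_ω0_le hω0
  have hx' := h'.of_ω0_le hω0'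
  -- Above `ω0` promises bind, so distinct promises mean distinct consumptions and the strict
  -- concavity of the period payoff passes to `value`.
  have hxx : x ≠ x' := fun he => hne (Real.exp_injective (by linarith))
  have := E.objective_mix_lt ⟨h.1.pos, h.1.lt_one⟩ ⟨h'.1.pos, h'.1.lt_one⟩ hxx h.1.upper
    h'.1.upper ha hb hab
  rw [h.objective_eq, h'.objective_eq] at this
  exact this.trans_le (h.1.mix h'.1 ha hb hab).objective_le_value

lemma strictConcaveOn_value (s : Fin (n + 2)) :
    StrictConcaveOn ℝ (Set.Icc (E.ω0 s) (E.ωmax s)) (E.value s) :=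
  ⟨convex_Icc _ _, fun _ hx _ hy hne _ _ ha hb hab =>
    E.value_mix_lt hx.1 hy.1 hx.2 hy.2 hne ha hb hab⟩

/-! ### Optimal policies -/

variable {E} in
-- Raising promises up to `ω0` is free, because `value` is flat there, and it relaxes participation.
lemma Solves.sup_ω0 {s : Fin (n + 2)} {ω x : ℝ} {w : Fin (n + 2) → ℝ}
    (h : E.Solves s ω x w) : E.Solves s ω x (w ⊔ E.ω0) := by
  refine (h.1.sup fun r => (E.ω0_mem r).2).solves ?_
  rw [← h.objective_eq]
  refine le_of_eq ?_
  simp only [objective]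
  congr 2
  refine sum_congr rfl fun r _ => ?_
  rcases le_total (w r) (E.ω0 r) with hr | hr
  · simp only [Pi.sup_apply, sup_of_le_right hr]
    rw [E.value_eq_of_le_ω0 (h.1.lower r) hr, E.value_eq_of_le_ω0 (E.ω0_mem r).1 le_rfl]
  · simp only [Pi.sup_apply, sup_of_le_left hr]

variable {E} in
lemma Solves.promise_unique {s : Fin (n + 2)} {ω x x' : ℝ} {w w' : Fin (n + 2) → ℝ}
    (h : E.Solves s ω x w) (h' : E.Solves s ω x' w') (hw : E.ω0 ≤ w) (hw' : E.ω0 ≤ w') :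
    w = w' := by
  obtain rfl := h.unique h'
  by_contra hne
  obtain ⟨r, hr⟩ := Function.ne_iff.1 hne
  have hab : (1 / 2 : ℝ) + 1 / 2 = 1 := by norm_num
  have hf := h.1.mix h'.1 one_half_pos one_half_pos hab
  rw [← add_mul, hab, one_mul, ← add_mul, hab, one_mul] at hf
  have hle := h.2 _ _ hf
  have he := h.objective_eq.trans h'.objective_eq.symm
  have hlt : (1 / 2) * ∑ r, E.prob r * E.value r (w r)
      + (1 / 2) * ∑ r, E.prob r * E.value r (w' r)
      < ∑ r, E.prob r * E.value r (((1 / 2 : ℝ) • w + (1 / 2 : ℝ) • w') r) := by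
    rw [mul_sum, mul_sum, ← sum_add_distrib]
    refine sum_lt_sum (fun r _ => ?_) ⟨r, mem_univ r, ?_⟩
    · have := mul_le_mul_of_nonneg_left (E.value_mix (h.1.upper r) (h'.1.upper r) one_half_pos
        one_half_pos hab) (E.prob_pos r).le
      exact le_trans (le_of_eq (by ring)) this
    · have := mul_lt_mul_of_pos_left (E.value_mix_lt (hw r) (hw' r) (h.1.upper r) (h'.1.upper r)
        hr one_half_pos one_half_pos hab) (E.prob_pos r)
      exact lt_of_le_of_lt (le_of_eq (by ring)) this
  have := mul_lt_mul_of_pos_left hlt E.δ_pos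
  simp only [objective] at hle he
  linarith

variable {E} in
lemma Solves.isPolicy {s : Fin (n + 2)} {ω x : ℝ} {w : Fin (n + 2) → ℝ}
    (h : E.Solves s ω x w) (hw : E.ω0 ≤ w) : E.IsPolicy s ω x w :=
  ⟨h, fun _ _ h' => le_sup_left.trans (h.promise_unique h'.sup_ω0 hw le_sup_right).ge⟩

lemma isPolicy {s : Fin (n + 2)} {ω : ℝ} (hω : ω ≤ E.ωmax s) :
    E.IsPolicy s ω (E.f s ω) fun r => E.g r s ω := by
  obtain ⟨x, w, h⟩ := E.exists_solves hω
  exact Classical.epsilon_spec (p := fun p : ℝ × (Fin (n + 2) → ℝ) => E.IsPolicy s ω p.1 p.2)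
    ⟨(x, w ⊔ E.ω0), h.sup_ω0.isPolicy le_sup_right⟩

lemma ω0_le_g (r : Fin (n + 2)) {s : Fin (n + 2)} {ω : ℝ} (hω : ω ≤ E.ωmax s) :
    E.ω0 r ≤ E.g r s ω :=
  have h := E.isPolicy hω
  le_sup_right.trans (h.2 _ _ h.1.sup_ω0 r)

variable {E} in
lemma Solves.g_eq {s : Fin (n + 2)} {ω x : ℝ} {w : Fin (n + 2) → ℝ}
    (h : E.Solves s ω x w) (hw : E.ω0 ≤ w) (r : Fin (n + 2)) : E.g r s ω = w r :=
  congrFun ((E.isPolicy h.1.le_ωmax).1.promise_unique h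
    (fun r => E.ω0_le_g r h.1.le_ωmax) hw) r

lemma f_of_ω0_le {s : Fin (n + 2)} {ω : ℝ} (h0 : E.ω0 s ≤ ω) (hω : ω ≤ E.ωmax s) :
    E.f s ω = 1 - Real.exp ω :=
  (E.isPolicy hω).1.of_ω0_le h0

lemma f_of_le_ω0 {s : Fin (n + 2)} {ω : ℝ} (hω : E.ωmin s ≤ ω) (h0 : ω ≤ E.ω0 s) :
    E.f s ω = 1 - Real.exp (E.ω0 s) :=
  (E.isPolicy (h0.trans (E.ω0_mem s).2)).1.of_le_ω0 hω h0

/-! ### The static optimum -/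

/-- The maximizer of the planner's payoff within a period. -/
def bliss : ℝ := E.δ / (E.β + E.δ)

lemma bliss_pos : 0 < E.bliss := div_pos E.δ_pos (add_pos E.β_pos E.δ_pos)

lemma one_sub_bliss : 1 - E.bliss = E.β / (E.β + E.δ) := by
  have := add_pos E.β_pos E.δ_pos
  rw [bliss]; field_simp; ring

lemma bliss_lt_one : E.bliss < 1 := by
  have := div_pos E.β_pos (add_pos E.β_pos E.δ_pos)
  linarith [E.one_sub_bliss]

lemma hasDerivAt_periodPayoff {x : ℝ} (h0 : 0 < x) (h1 : x < 1) :
    HasDerivAt E.periodPayoff (1 / x - E.β / E.δ / (1 - x)) x := by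
  have h2 := (((hasDerivAt_id x).const_sub 1).log (sub_pos.2 h1).ne').const_mul (E.β / E.δ)
  refine (h2.add (Real.hasDerivAt_log h0.ne')).congr_deriv ?_
  simp only [id]
  ring

lemma hasDerivAt_periodPayoff_bliss : HasDerivAt E.periodPayoff 0 E.bliss := by
  convert E.hasDerivAt_periodPayoff E.bliss_pos E.bliss_lt_one using 1
  have := add_pos E.β_pos E.δ_pos
  have := E.β_pos
  have := E.δ_pos
  rw [one_sub_bliss, bliss]; field_simp; ring

/-- The inequality `log t ≤ t - 1` at `x / bliss` and `(1 - x) / (1 - bliss)`, weighted by `1` and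
`β / δ`; the linear parts cancel. -/
lemma periodPayoff_le_bliss {x : ℝ} (h0 : 0 < x) (h1 : x < 1) :
    E.periodPayoff x ≤ E.periodPayoff E.bliss := by
  have hb := E.bliss_pos
  have hb1 := sub_pos.2 E.bliss_lt_one
  have h2 := Real.log_le_sub_one_of_pos (div_pos h0 hb)
  have h3 := mul_le_mul_of_nonneg_left
    (Real.log_le_sub_one_of_pos (div_pos (sub_pos.2 h1) hb1)) (div_pos E.β_pos E.δ_pos).le
  rw [Real.log_div h0.ne' hb.ne'] at h2
  rw [Real.log_div (sub_pos.2 h1).ne' hb1.ne'] at h3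
  have h4 : E.β / E.δ * ((1 - x) / (1 - E.bliss) - 1) + (x / E.bliss - 1) = 0 := by
    have := add_pos E.β_pos E.δ_pos
    have := E.β_pos
    have := E.δ_pos
    rw [one_sub_bliss, bliss]; field_simp; ring
  simp only [periodPayoff]
  linarith

lemma periodPayoff_lt {x y : ℝ} (h0 : 0 < x) (hxy : x < y) (hy : y ≤ E.bliss) :
    E.periodPayoff x < E.periodPayoff y := by
  have hb := E.bliss_lt_one
  have hlt : ∀ {x}, 0 < x → x < E.bliss → E.periodPayoff x < E.periodPayoff E.bliss := by
    intro x h0 hx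
    have h1 := E.strictConcaveOn_periodPayoff.2 (x := x) (y := E.bliss) ⟨h0, hx.trans hb⟩
      ⟨E.bliss_pos, hb⟩ hx.ne one_half_pos one_half_pos (by norm_num)
    have h2 := E.periodPayoff_le_bliss (x := (1 / 2 : ℝ) • x + (1 / 2 : ℝ) • E.bliss)
      (by simp only [smul_eq_mul]; linarith [E.bliss_pos])
      (by simp only [smul_eq_mul]; linarith)
    simp only [smul_eq_mul] at h1 h2
    linarith
  rcases hy.eq_or_lt with rfl | hy
  · exact hlt h0 hxy
  have hx := hlt h0 (hxy.trans hy)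
  have := E.strictConcaveOn_periodPayoff.slope_anti_adjacent ⟨h0, hxy.trans (hy.trans hb)⟩
    ⟨E.bliss_pos, hb⟩ hxy hy
  have hd : 0 ≤ (E.periodPayoff E.bliss - E.periodPayoff y) / (E.bliss - y) :=
    div_nonneg (sub_nonneg.2 (hlt (h0.trans hxy) hy).le) (sub_pos.2 hy).le
  have := (div_pos_iff_of_pos_right (sub_pos.2 hxy)).1 (hd.trans_lt this)
  linarith

lemma cstar_eq (s : Fin (n + 2)) : E.cstar s = min E.bliss (E.share s) := rfl

/-! ### Comparison of perturbed promises -/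

lemma sum_update (p w : Fin (n + 2) → ℝ) (F : Fin (n + 2) → ℝ → ℝ) (r : Fin (n + 2)) (z : ℝ) :
    ∑ i, p i * F i (Function.update w r z i)
      = ∑ i, p i * F i (w i) + p r * (F r z - F r (w r)) := by
  rw [← add_sum_erase _ _ (mem_univ r), ← add_sum_erase univ (fun i => p i * F i (w i))
    (mem_univ r)]
  have : ∑ i ∈ univ.erase r, p i * F i (Function.update w r z i)
      = ∑ i ∈ univ.erase r, p i * F i (w i) :=
    sum_congr rfl fun i hi => by rw [Function.update_of_ne (ne_of_mem_erase hi)]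
  rw [this, Function.update_self]
  ring

variable {E} in
/-- A lower bound for the value obtained by changing consumption and the promise in one state. -/
lemma Solves.value_add_le {s : Fin (n + 2)} {ω ω' x x' z : ℝ} {w : Fin (n + 2) → ℝ}
    (h : E.Solves s ω x w) (r : Fin (n + 2)) (hx' : 0 < x') (hs : x' ≤ E.share s)
    (hω' : ω' ≤ Real.log (1 - x')) (hz : E.ωmin r ≤ z) (hz' : z ≤ E.ωmax r)
    (hy : E.β * E.prob r * (w r - z) ≤ Real.log x' - Real.log x) :
    E.value s ω + (E.periodPayoff x' - E.periodPayoff x)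
      + E.δ * E.prob r * (E.value r z - E.value r (w r)) ≤ E.value s ω' := by
  have hf : E.Feasible s ω' x' (Function.update w r z) := by
    refine ⟨hx', hω', hs, fun i => ?_, fun i => ?_, ?_⟩
    · rcases eq_or_ne i r with rfl | hi
      · simpa using hz'
      · simpa [hi] using h.1.upper i
    · rcases eq_or_ne i r with rfl | hi
      · simpa using hz
      · simpa [hi] using h.1.lower i
    · have := h.1.young
      rw [sum_update E.prob w (fun _ y => y)]
      linarith
  have := hf.objective_le_value
  rw [objective, sum_update E.prob w E.value] at this
  rw [← h.objective_eq, objective]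
  linarith

lemma deriv_nonpos_of_eventually_nonpos {φ : ℝ → ℝ} {d : ℝ}
    (hd : HasDerivWithinAt φ d (Set.Ioi 0) 0)
    (h0 : φ 0 = 0) (h : ∀ᶠ ε in nhdsWithin 0 (Set.Ioi 0), φ ε ≤ 0) : d ≤ 0 := by
  rw [hasDerivWithinAt_iff_tendsto_slope' (by simp)] at hd
  refine le_of_tendsto hd ?_
  filter_upwards [h, self_mem_nhdsWithin] with ε hε (hpos : 0 < ε)
  rw [slope_def_field, h0, sub_zero, sub_zero]
  exact div_nonpos_of_nonpos_of_nonneg hε hpos.le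

/-- Chord bounds like this one take the place of derivatives of `value`, so its differentiability is
never needed. -/
lemma line_le_value {s : Fin (n + 2)} {m u z : ℝ} (hmu : m < u) (hu : u ≤ E.ωmax s)
    (hz : m ≤ z) (hz' : z ≤ u) :
    E.value s u + (E.value s u - E.value s m) / (u - m) * (z - u) ≤ E.value s z := by
  have hpos := sub_pos.2 hmu
  have hm : m ∈ Set.Iic (E.ωmax s) := hmu.le.trans hu
  have h := (E.concaveOn_value s).2 hm (Set.mem_Iic.2 hu)
    (div_nonneg (sub_nonneg.2 hz') hpos.le) (div_nonneg (sub_nonneg.2 hz) hpos.le)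
    (by field_simp; ring)
  simp only [smul_eq_mul] at h
  have e1 : (u - z) / (u - m) * m + (z - m) / (u - m) * u = z := by
    field_simp; ring
  rw [e1] at h
  refine le_trans (le_of_eq ?_) h
  field_simp
  ring

/-! ### Consumption at the reset promise -/

lemma c0_eq (s : Fin (n + 2)) : E.c0 s = 1 - Real.exp (E.ω0 s) :=
  E.f_of_ω0_le le_rfl (E.ω0_mem s).2

lemma ω0_eq_log (s : Fin (n + 2)) : E.ω0 s = Real.log (1 - E.c0 s) := by
  simp [c0_eq]

lemma exists_solves_c0 (s : Fin (n + 2)) :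
    ∃ w, E.Solves s (E.ωmin s) (E.c0 s) w := by
  have h := (E.isPolicy (E.ωmin_le_ωmax s)).1
  rw [E.f_of_le_ω0 le_rfl (E.ω0_mem s).1, ← c0_eq] at h
  exact ⟨_, h⟩

/-- Below both the static optimum and the share, more consumption for the young raises the period
payoff and relaxes participation. -/
lemma cstar_le_c0 (s : Fin (n + 2)) : E.cstar s ≤ E.c0 s := by
  obtain ⟨w, h⟩ := E.exists_solves_c0 s
  by_contra! hlt
  have hle : E.cstar s ≤ E.share s := min_le_right _ _
  have hf : E.Feasible s (E.ωmin s) (E.cstar s) w := by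
    refine ⟨h.1.pos.trans hlt, Real.log_le_log (E.one_sub_share_pos s) (by linarith), hle,
      h.1.upper, h.1.lower, h.1.young.trans ?_⟩
    gcongr
    exact h.1.pos
  have h1 := h.2 _ _ hf
  have h2 := E.periodPayoff_lt h.1.pos hlt (min_le_left _ _)
  simp only [objective] at h1
  linarith

lemma c0_mono_of_lt {s s' : Fin (n + 2)} (hss : s < s') : E.c0 s ≤ E.c0 s' := by
  obtain ⟨w, h⟩ := E.exists_solves_c0 s
  obtain ⟨w', h'⟩ := E.exists_solves_c0 s'
  by_contra! hlt
  have hsh := E.share_strictMono hss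
  have hσ := Real.log_lt_log (E.share_pos s) hsh
  have hy := Real.log_lt_log h'.1.pos hlt
  set D := (Real.log (E.share s') - Real.log (E.share s))
    + (Real.log (E.c0 s) - Real.log (E.c0 s')) with hD
  have hDpos : 0 < D := by linarith
  -- Consumptions are exchanged between the states and promises mixed. The weight `t`, the
  -- consumption part of the total log gap `D`, makes both new participation constraints convex
  -- combinations of the old ones.
  obtain ⟨t, u, ht, hu, htu, hteq⟩ : ∃ t u : ℝ, 0 < t ∧ 0 < u ∧ t + u = 1 ∧
      t * D = Real.log (E.c0 s) - Real.log (E.c0 s') :=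
    ⟨(Real.log (E.c0 s) - Real.log (E.c0 s')) / D,
      (Real.log (E.share s') - Real.log (E.share s)) / D, div_pos (by linarith) hDpos,
      div_pos (by linarith) hDpos, by rw [← add_div, div_eq_one_iff_eq hDpos.ne', hD]; ring,
      div_mul_cancel₀ _ hDpos.ne'⟩
  obtain rfl : u = 1 - t := by linarith
  have hsum : ∀ (a b : ℝ), ∑ r, E.prob r * (a • w + b • w') r
      = a * ∑ r, E.prob r * w r + b * ∑ r, E.prob r * w' r := fun a b => by
    rw [mul_sum, mul_sum, ← sum_add_distrib]
    exact sum_congr rfl fun r _ => by simp; ring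
  have hm := convex_Icc (𝕜 := ℝ) E.ωmin E.ωmax ⟨h.1.lower, h.1.upper⟩ ⟨h'.1.lower, h'.1.upper⟩
  have hm1 := hm ht.le hu.le htu
  have hm2 := hm hu.le ht.le (by linarith)
  have hy1 := h.1.young
  have hy2 := h'.1.young
  have ha1 := mul_le_mul_of_nonneg_left hy1 ht.le
  have ha2 := mul_le_mul_of_nonneg_left hy2 hu.le
  have hb1 := mul_le_mul_of_nonneg_left hy1 hu.le
  have hb2 := mul_le_mul_of_nonneg_left hy2 ht.le
  have haut : E.autarky s' - E.autarky s = Real.log (E.share s') - Real.log (E.share s) := by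
    simp [autarky]
  have hteq' : t * (E.autarky s' - E.autarky s)
      + t * (Real.log (E.c0 s) - Real.log (E.c0 s'))
      = Real.log (E.c0 s) - Real.log (E.c0 s') := by
    linear_combination t * haut + hteq - t * hD
  have hf1 : E.Feasible s' (E.ωmin s') (E.c0 s) (t • w + (1 - t) • w') := by
    refine ⟨h.1.pos, Real.log_le_log (E.one_sub_share_pos s') (by linarith [h.1.old]),
      h.1.old.trans hsh.le, hm1.2, hm1.1, ?_⟩
    rw [hsum]
    linarith
  have hf2 : E.Feasible s (E.ωmin s) (E.c0 s') ((1 - t) • w + t • w') := by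
    refine ⟨h'.1.pos, Real.log_le_log (E.one_sub_share_pos s) (by linarith [h.1.old]),
      hlt.le.trans h.1.old, hm2.2, hm2.1, ?_⟩
    rw [hsum]
    linarith
  -- The exchange keeps the sum of the period payoffs, and by concavity does not lower the sum of
  -- continuation values. Hence it is optimal in `s'` too, against uniqueness of consumption.
  have hv1 := E.sum_value_mix h.1.upper h'.1.upper ht hu htu
  have hv2 := E.sum_value_mix h.1.upper h'.1.upper hu ht (by linarith)
  have hv := mul_le_mul_of_nonneg_left (add_le_add hv1 hv2) E.δ_pos.le
  have ho1 := h'.2 _ _ hf1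
  have ho2 := h.2 _ _ hf2
  have hs1 : E.Solves s' (E.ωmin s') (E.c0 s) (t • w + (1 - t) • w') := by
    refine hf1.solves ?_
    rw [← h'.objective_eq]
    simp only [objective] at *
    linarith
  linarith [hs1.unique h']

open Filter Topology in
lemma exists_c0_lt (h_low : E.share 0 ≤ E.bliss)
    (h_nofb : Real.log (E.cstar (Fin.last (n + 1)))
        + E.β * ∑ r, E.prob r * Real.log (1 - E.cstar r) < E.autarky (Fin.last (n + 1))) :
    ∃ i : Fin (n + 1), E.c0 i.castSucc < E.c0 i.succ := by
  by_contra! hge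
  have hconst : ∀ s, E.c0 s = E.c0 0 := fun s => by
    induction s using Fin.induction with
    | zero => rfl
    | succ i ih =>
      rw [← ih]
      exact le_antisymm (hge i) (E.c0_mono_of_lt (Fin.castSucc_lt_succ))
  set l := Fin.last (n + 1) with hl
  have hsl : E.share 0 < E.share l := E.share_strictMono (Fin.last_pos)
  -- The common value is squeezed: at most the lowest share, hence at most `bliss`, and at least the
  -- first best of the highest state, which must then be `bliss`.
  have h0 : E.c0 0 ≤ E.share 0 := by
    obtain ⟨w, h⟩ := E.exists_solves_c0 0
    exact h.1.old
  have hl' := E.cstar_le_c0 l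
  rw [hconst, cstar_eq] at hl'
  have hbl : E.bliss < E.share l := by
    by_contra! hc
    rw [min_eq_right hc] at hl'
    linarith
  rw [min_eq_left hbl.le] at hl'
  have hc0 : ∀ s, E.c0 s = E.bliss := fun s => by rw [hconst]; linarith
  have hcs : ∀ s, E.cstar s = E.bliss := fun s =>
    min_eq_left ((hl'.trans h0).trans (E.share_strictMono.monotone (Fin.zero_le s)))
  obtain ⟨w, h⟩ := E.exists_solves_c0 l
  simp only [hcs] at h_nofb
  rw [hc0] at h
  have hlt := h_nofb.trans_le h.1.young
  -- Promises all at or below `ω0 = log (1 - bliss)` would give the young no more than the first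
  -- best, which violates participation.
  obtain ⟨r, hr⟩ : ∃ r, E.ω0 r < w r := by
    by_contra! hall
    have : ∑ r, E.prob r * w r ≤ ∑ r, E.prob r * Real.log (1 - E.bliss) :=
      sum_le_sum fun r _ => mul_le_mul_of_nonneg_left
        ((hall r).trans_eq (by rw [ω0_eq_log, hc0])) (E.prob_pos r).le
    have := mul_le_mul_of_nonneg_left this E.β_pos.le
    linarith
  set A := (E.value r (w r) - E.value r (E.ω0 r)) / (w r - E.ω0 r) with hA
  have hAneg : A < 0 := div_neg_of_neg_of_pos
    (sub_neg.2 (E.value_lt_of_ω0_lt hr (h.1.upper r))) (sub_pos.2 hr)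
  have hβπ := mul_pos E.β_pos (E.prob_pos r)
  have hδπ := mul_pos E.δ_pos (E.prob_pos r)
  -- The cut in the promise for `r` that `ε` more consumption pays for. Its gain is of first order,
  -- while the period payoff is stationary at `bliss`.
  set G : ℝ → ℝ := fun ε =>
    (Real.log (E.bliss + ε) - Real.log E.bliss) / (E.β * E.prob r) with hG
  have hlin : HasDerivAt (fun ε : ℝ => E.bliss + ε) 1 0 := (hasDerivAt_id 0).const_add _
  have hGd : HasDerivAt G (1 / E.bliss / (E.β * E.prob r)) 0 := by
    have := (hlin.log (by simpa using E.bliss_pos.ne')).sub_const (Real.log E.bliss)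
    simpa using this.div_const (E.β * E.prob r)
  have hPd : HasDerivAt (fun ε => E.periodPayoff (E.bliss + ε)) 0 0 := by
    have := HasDerivAt.comp (0 : ℝ) (h₂ := E.periodPayoff) (h₂' := 0)
      (by simpa using E.hasDerivAt_periodPayoff_bliss) hlin
    simpa [Function.comp_def] using this
  have hφ := ((hPd.sub_const (E.periodPayoff E.bliss)).add
    (hGd.const_mul (-(E.δ * E.prob r * A)))).hasDerivWithinAt (s := Set.Ioi 0)
  have hG0 : G 0 = 0 := by simp [hG]
  have hGpos : ∀ ε, 0 < ε → 0 ≤ G ε := fun ε hε => div_nonneg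
    (sub_nonneg.2 (Real.log_le_log E.bliss_pos (by linarith))) hβπ.le
  have hGsmall : ∀ᶠ ε in 𝓝[>] (0 : ℝ), G ε < w r - E.ω0 r :=
    (hGd.continuousAt.eventually_lt continuousAt_const (by simpa [hG0] using hr)).filter_mono
      nhdsWithin_le_nhds
  have hεs : ∀ᶠ ε in 𝓝[>] (0 : ℝ), ε < E.share l - E.bliss :=
    (eventually_lt_nhds (sub_pos.2 hbl)).filter_mono nhdsWithin_le_nhds
  have key := deriv_nonpos_of_eventually_nonpos hφ (by simp [hG0]) (by
    filter_upwards [hGsmall, hεs, self_mem_nhdsWithin] with ε h1 h2 (h3 : 0 < ε)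
    have h4 := hGpos ε h3
    have h5 := h.value_add_le (ω' := E.ωmin l) (x' := E.bliss + ε) (z := w r - G ε) r
      (by linarith [E.bliss_pos]) (by linarith)
      (Real.log_le_log (E.one_sub_share_pos l) (by linarith))
      (by linarith [(E.ω0_mem r).1]) (by linarith [h.1.upper r])
      (by
        have : E.β * E.prob r * G ε = Real.log (E.bliss + ε) - Real.log E.bliss :=
          mul_div_cancel₀ _ hβπ.ne'
        linarith)
    have h6 := mul_le_mul_of_nonneg_left
      (E.line_le_value hr (h.1.upper r) (z := w r - G ε) (by linarith) (by linarith)) hδπ.le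
    rw [← hA] at h6
    simp only [Pi.add_apply]
    linarith)
  have : 0 < -(E.δ * E.prob r * A) * (1 / E.bliss / (E.β * E.prob r)) :=
    mul_pos (by nlinarith) (div_pos (one_div_pos.2 E.bliss_pos) hβπ)
  linarith

/-! ### First-order conditions along a repeated state -/

lemma ωmax_neg (s : Fin (n + 2)) : E.ωmax s < 0 := by
  rw [ωmax_eq]
  refine Real.log_neg ?_ (by linarith [E.minFraction_mul_pos s])
  linarith [E.minFraction_mul_le s, E.share_lt_one s]

lemma one_sub_exp_pos {s : Fin (n + 2)} {ω : ℝ} (hω : ω ≤ E.ωmax s) : 0 < 1 - Real.exp ω :=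
  sub_pos.2 (Real.exp_zero ▸ Real.exp_lt_exp.2 (hω.trans_lt (E.ωmax_neg s)))

lemma one_sub_exp_le_share {s : Fin (n + 2)} {ω : ℝ} (hω : E.ωmin s ≤ ω) :
    1 - Real.exp ω ≤ E.share s := by
  have := (Real.log_le_iff_le_exp (E.one_sub_share_pos s)).1 hω
  linarith

open Filter Topology in
/-- First-order condition for a marginal change of the promise in the direction `σ` that is
compensated by a change of the promise for the repetition of the state. -/
lemma first_order {s : Fin (n + 2)} {ω x : ℝ} {w : Fin (n + 2) → ℝ} (h : E.Solves s ω x w)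
    (h0 : E.ω0 s ≤ ω) {σ A B : ℝ} (hσ : σ = 1 ∨ σ = -1)
    (hB : ∀ᶠ ε in 𝓝[>] (0 : ℝ), ω + σ * ε ∈ E.promises s ∧
      E.value s (ω + σ * ε) - E.value s ω ≤ B * ε)
    (hA : ∀ᶠ ε in 𝓝[>] (0 : ℝ), w s + σ * ε ∈ E.promises s ∧
      A * ε ≤ E.value s (w s + σ * ε) - E.value s (w s)) :
    σ * (E.β / E.δ - (1 - x) / x) + E.δ / E.β * ((1 - x) / x) * A ≤ B := by
  have hx := h.of_ω0_le h0
  have hxω : 1 - x = Real.exp ω := by linarith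
  have hlog : Real.log (1 - x) = ω := by rw [hxω, Real.log_exp]
  have hσσ : σ * σ = 1 := by rcases hσ with rfl | rfl <;> norm_num
  have hβπ := mul_pos E.β_pos (E.prob_pos s)
  have hδπ := mul_pos E.δ_pos (E.prob_pos s)
  have hδ := E.δ_pos
  have hβ := E.β_pos
  have hπ := E.prob_pos s
  have hxpos := h.1.pos
  set X : ℝ → ℝ := fun ε => 1 - Real.exp (ω + σ * ε) with hX
  have hX0 : X 0 = x := by simp [hX, hx]
  have hlin : HasDerivAt (fun ε : ℝ => ω + σ * ε) σ 0 := by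
    simpa using ((hasDerivAt_id (0 : ℝ)).const_mul σ).const_add ω
  have hXd : HasDerivAt X (-(σ * (1 - x))) 0 := by
    refine (hlin.exp.const_sub 1).congr_deriv ?_
    simp only [mul_zero, add_zero, hxω]; ring
  -- The size of the change in the promise for `s` that keeps the young as well off when their
  -- consumption moves to `X ε`; it has the same direction `σ` as the change in `ω`.
  set G : ℝ → ℝ := fun ε => σ * (Real.log x - Real.log (X ε)) / (E.β * E.prob s) with hG
  have hGd : HasDerivAt G ((1 - x) / x / (E.β * E.prob s)) 0 := by
    refine ((((hXd.log (by rw [hX0]; exact hxpos.ne')).const_sub (Real.log x)).const_mul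
      σ).div_const (E.β * E.prob s)).congr_deriv ?_
    rw [hX0]
    have : σ * -(-(σ * (1 - x)) / x) = (1 - x) / x := by
      linear_combination (1 - x) / x * hσσ
    rw [this]
  have hG0 : G 0 = 0 := by simp [hG, hX0]
  have hβG : ∀ ε, E.β * E.prob s * G ε = σ * (Real.log x - Real.log (X ε)) := fun ε =>
    mul_div_cancel₀ _ hβπ.ne'
  have hPd : HasDerivAt (fun ε => E.periodPayoff (X ε)) (σ * (E.β / E.δ - (1 - x) / x)) 0 := by
    have := HasDerivAt.comp (0 : ℝ) (h₂ := E.periodPayoff)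
      (by rw [hX0]; exact E.hasDerivAt_periodPayoff hxpos h.1.lt_one) hXd
    refine this.congr_deriv ?_
    have := sub_pos.2 h.1.lt_one
    field_simp
    ring
  have hφ := (((hPd.sub_const (E.periodPayoff x)).add (hGd.const_mul (E.δ * E.prob s * A))).sub
    ((hasDerivAt_id (0 : ℝ)).const_mul B)).hasDerivWithinAt (s := Set.Ioi 0)
  have hGpos : ∀ᶠ ε in 𝓝[>] (0 : ℝ), 0 < G ε := by
    filter_upwards [hB, self_mem_nhdsWithin] with ε h1 (h2 : 0 < ε)
    have hXpos : 0 < X ε := E.one_sub_exp_pos h1.1.2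
    refine div_pos ?_ hβπ
    rcases hσ with rfl | rfl
    · have : X ε < x := by
        have := Real.exp_lt_exp.2 (show ω < ω + 1 * ε by linarith)
        simp only [hX]; linarith
      linarith [Real.log_lt_log hXpos this]
    · have : x < X ε := by
        have := Real.exp_lt_exp.2 (show ω + -1 * ε < ω by linarith)
        simp only [hX]; linarith
      linarith [Real.log_lt_log hxpos this]
  -- The bound `hA` is applied at the step `G ε`, which must tend to zero from the right.
  have hGt : Tendsto G (𝓝[>] 0) (𝓝[>] 0) := by
    refine tendsto_nhdsWithin_iff.2 ⟨?_, hGpos⟩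
    have := hGd.continuousAt.tendsto
    rw [hG0] at this
    exact this.mono_left nhdsWithin_le_nhds
  have key := deriv_nonpos_of_eventually_nonpos hφ (by simp [hG0, hX0]) (by
    filter_upwards [hB, hGt.eventually hA] with ε h1 h2
    have h3 := h.value_add_le (ω' := ω + σ * ε) (x' := X ε) (z := w s + σ * G ε) s
      (E.one_sub_exp_pos h1.1.2) (E.one_sub_exp_le_share h1.1.1) (by simp [hX]) h2.1.1 h2.1.2
      (by
        have : E.β * E.prob s * (w s - (w s + σ * G ε)) = -(σ * (E.β * E.prob s * G ε)) := by
          ring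
        rw [this, hβG]
        linear_combination (Real.log (X ε) - Real.log x) * hσσ)
    have h4 := mul_le_mul_of_nonneg_left h2.2 hδπ.le
    simp only [Pi.add_apply, Pi.sub_apply, id]
    linarith [h1.2])
  have e : E.δ * E.prob s * A * ((1 - x) / x / (E.β * E.prob s))
      = E.δ / E.β * ((1 - x) / x) * A := by
    field_simp
  linarith

open Filter Topology in
lemma exists_right_deriv {s : Fin (n + 2)} {ω : ℝ} (hω : ω < E.ωmax s) (σ : ℝ) :
    ∃ R, HasDerivWithinAt (fun ε => E.value s (ω + σ * ε)) R (Set.Ioi 0) 0 := by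
  set S : Set ℝ := {ε | ω + σ * ε ≤ E.ωmax s} with hS
  have hc : ConvexOn ℝ S (fun ε => -E.value s (ω + σ * ε)) := by
    refine ConcaveOn.neg (f := fun ε => E.value s (ω + σ * ε)) ?_
    have he : ∀ {a b : ℝ} (x y : ℝ), a + b = 1 →
        ω + σ * (a * x + b * y) = a * (ω + σ * x) + b * (ω + σ * y) := fun x y hab => by
      linear_combination -ω * hab
    refine concaveOn_iff_forall_pos.2 ⟨?_, ?_⟩
    · intro x hx y hy a b ha hb hab
      have := convex_Iic (𝕜 := ℝ) (E.ωmax s) hx hy ha hb hab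
      simp only [hS, Set.mem_ofPred_eq, smul_eq_mul, he x y hab]
      exact this
    · intro x hx y hy a b ha hb hab
      simp only [smul_eq_mul, he x y hab]
      exact E.value_mix hx hy ha hb hab
  have hint : (0 : ℝ) ∈ interior S := by
    rw [mem_interior_iff_mem_nhds]
    have hcont : ContinuousAt (fun ε : ℝ => ω + σ * ε) 0 := by fun_prop
    filter_upwards [hcont.eventually_lt continuousAt_const (by simpa using hω)] with ε hε
    exact hε.le
  have := (hc.hasDerivWithinAt_rightDeriv_of_mem_interior hint).neg
  exact ⟨_, this.congr_of_eventuallyEq (Filter.Eventually.of_forall fun _ => (neg_neg _).symm)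
    (neg_neg _).symm⟩

open Filter Topology in
lemma eventually_mem_promises {s : Fin (n + 2)} {u σ : ℝ} (hmin : σ = 1 ∨ E.ωmin s < u)
    (hmax : σ = -1 ∨ u < E.ωmax s) (hσ : σ = 1 ∨ σ = -1) (hu : u ∈ E.promises s) :
    ∀ᶠ ε in 𝓝[>] (0 : ℝ), u + σ * ε ∈ E.promises s := by
  have hcont : ContinuousAt (fun ε : ℝ => u + σ * ε) 0 := by fun_prop
  rcases hσ with rfl | rfl
  · have hlt := hmax.resolve_left (by norm_num)
    filter_upwards [(hcont.eventually_lt continuousAt_const (by simpa using hlt)).filter_mono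
      nhdsWithin_le_nhds, self_mem_nhdsWithin] with ε h1 (h2 : 0 < ε)
    exact ⟨by linarith [hu.1], h1.le⟩
  · have hlt := hmin.resolve_left (by norm_num)
    filter_upwards [(continuousAt_const.eventually_lt hcont (by simpa using hlt)).filter_mono
      nhdsWithin_le_nhds, self_mem_nhdsWithin] with ε h1 (h2 : 0 < ε)
    exact ⟨h1.le, by linarith [hu.2]⟩

open Filter Topology in
-- With `k = (1 - x) / x` and `R` the one-sided derivative of `value` in direction `σ`, the
-- condition reads `σ (β/δ - k) ≤ R (1 - (δ/β) k)`. The right side is `(δ/β) R (β/δ - k)`, and `σ R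
-- ≤ 0` by monotonicity, so the left side cannot be positive.
lemma first_order_repeated {s : Fin (n + 2)} {ω x : ℝ} {w : Fin (n + 2) → ℝ}
    (h : E.Solves s ω x w) (h0 : E.ω0 s ≤ ω) (hws : w s = ω) (hω : ω < E.ωmax s) {σ : ℝ}
    (hσ : σ = 1 ∨ σ = -1) (hmin : σ = 1 ∨ E.ωmin s < ω) :
    σ * (E.β / E.δ - (1 - x) / x) ≤ 0 := by
  have hpr : ω ∈ E.promises s := ⟨(E.ω0_mem s).1.trans h0, hω.le⟩
  have hmem := E.eventually_mem_promises hmin (Or.inr hω) hσ hpr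
  obtain ⟨R, hR⟩ := E.exists_right_deriv hω σ
  rw [hasDerivWithinAt_iff_tendsto_slope' (by simp)] at hR
  have hslope : ∀ ε : ℝ, slope (fun ε => E.value s (ω + σ * ε)) 0 ε
      = (E.value s (ω + σ * ε) - E.value s ω) / ε := fun ε => by
    simp [slope_def_field]
  set k := (1 - x) / x with hk
  have hkpos : 0 < k := div_pos (sub_pos.2 h.1.lt_one) h.1.pos
  have hc : 0 < E.δ / E.β * k := mul_pos (div_pos E.δ_pos E.β_pos) hkpos
  -- Difference quotients only approach `R`, hence the slack `η`, which is then sent to zero.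
  have hη : ∀ η, 0 < η → σ * (E.β / E.δ - k) + E.δ / E.β * k * (R - η) ≤ R + η := by
    intro η hη
    refine E.first_order h h0 hσ ?_ ?_
    · filter_upwards [hmem, hR.eventually (gt_mem_nhds (show R < R + η by linarith)),
        self_mem_nhdsWithin] with ε h1 h2 (h3 : 0 < ε)
      rw [hslope, div_lt_iff₀ h3] at h2
      exact ⟨h1, h2.le⟩
    · rw [hws]
      filter_upwards [hmem, hR.eventually (lt_mem_nhds (show R - η < R by linarith)),
        self_mem_nhdsWithin] with ε h1 h2 (h3 : 0 < ε)
      rw [hslope, lt_div_iff₀ h3] at h2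
      exact ⟨h1, h2.le⟩
  have hlim : σ * (E.β / E.δ - k) + E.δ / E.β * k * R ≤ R := by
    refine le_of_forall_pos_le_add fun ε hε => ?_
    have := hη (ε / (1 + E.δ / E.β * k)) (by positivity)
    have e : (1 + E.δ / E.β * k) * (ε / (1 + E.δ / E.β * k)) = ε :=
      mul_div_cancel₀ _ (by positivity)
    linarith
  have hRsign : σ * R ≤ 0 := by
    rcases hσ with rfl | rfl
    · have : R ≤ 0 := by
        refine le_of_tendsto hR ?_
        filter_upwards [hmem, self_mem_nhdsWithin] with ε h1 (h3 : 0 < ε)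
        rw [hslope]
        exact div_nonpos_of_nonpos_of_nonneg
          (sub_nonpos.2 (E.value_anti (by linarith) h1.2)) h3.le
      linarith
    · have : 0 ≤ R := by
        refine ge_of_tendsto hR ?_
        filter_upwards [hmem, self_mem_nhdsWithin] with ε h1 (h3 : 0 < ε)
        rw [hslope]
        exact div_nonneg (sub_nonneg.2 (E.value_anti (by linarith) hω.le)) h3.le
      linarith
  by_contra! hpos
  have e1 : 1 - E.δ / E.β * k = E.δ / E.β * (E.β / E.δ - k) := by
    have := E.β_pos
    have := E.δ_pos
    field_simp
  have e2 : R * (1 - E.δ / E.β * k) = σ * R * (E.δ / E.β * (σ * (E.β / E.δ - k))) := by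
    rw [e1]
    rcases hσ with rfl | rfl <;> ring
  have e3 : R * (1 - E.δ / E.β * k) ≤ 0 := by
    rw [e2]
    exact mul_nonpos_of_nonpos_of_nonneg hRsign
      (mul_pos (div_pos E.δ_pos E.β_pos) hpos).le
  linarith

/-! ### Fixed points -/

lemma ωstar_eq (s : Fin (n + 2)) : E.ωstar s = Real.log (1 - E.cstar s) := by
  rw [ωstar, ← one_sub_bliss, ωmin, cstar_eq]
  have hs := E.one_sub_share_pos s
  have hb := sub_pos.2 E.bliss_lt_one
  rcases le_total E.bliss (E.share s) with h | h
  · rw [min_eq_left h, max_eq_right (Real.log_le_log hs (by linarith))]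
  · rw [min_eq_right h, max_eq_left (Real.log_le_log hb (by linarith))]

lemma cstar_lt_one (s : Fin (n + 2)) : E.cstar s < 1 :=
  (min_le_right _ _).trans_lt (E.share_lt_one s)

lemma one_sub_exp_ωstar (s : Fin (n + 2)) : 1 - Real.exp (E.ωstar s) = E.cstar s := by
  rw [ωstar_eq, Real.exp_log (sub_pos.2 (E.cstar_lt_one s))]
  ring

lemma ω0_le_ωstar (s : Fin (n + 2)) : E.ω0 s ≤ E.ωstar s := by
  have h : E.c0 s < 1 := by rw [c0_eq]; linarith [Real.exp_pos (E.ω0 s)]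
  rw [ωstar_eq, ω0_eq_log]
  exact Real.log_le_log (by linarith) (by linarith [E.cstar_le_c0 s])

/-- Consumption is then minimal and participation requires the expected promise to reach its upper
bound; as all probabilities are positive, each promise does. -/
lemma g_ωmax (r s : Fin (n + 2)) : E.g r s (E.ωmax s) = E.ωmax r := by
  have h := (E.isPolicy (le_refl (E.ωmax s))).1
  have hx := h.of_ω0_le (E.ω0_mem s).2
  have hexp : 1 - Real.exp (E.ωmax s) = E.minFraction * E.share s := by
    have := E.minFraction_mul_le s
    have := E.share_lt_one s
    rw [ωmax_eq, Real.exp_log (by linarith)]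
    ring
  rw [hexp] at hx
  have hy := h.1.young
  rw [hx, log_minFraction_mul, maxGain_eq, autarky] at hy
  have hsum : ∑ r, E.prob r * E.ωmax r ≤ ∑ r, E.prob r * E.g r s (E.ωmax s) := by
    simp only [mul_sub, sum_sub_distrib] at hy
    have : E.β * ∑ r, E.prob r * E.ωmax r ≤ E.β * ∑ r, E.prob r * E.g r s (E.ωmax s) := by
      simp only [ωmin] at hy
      linarith
    exact le_of_mul_le_mul_left this E.β_pos
  have hle : ∀ r ∈ univ, E.prob r * E.g r s (E.ωmax s) ≤ E.prob r * E.ωmax r :=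
    fun r _ => mul_le_mul_of_nonneg_left (h.1.upper r) (E.prob_pos r).le
  exact mul_left_cancel₀ (E.prob_pos r).ne'
    ((sum_eq_sum_iff_of_le hle).1 (le_antisymm (sum_le_sum hle) hsum) r (mem_univ r))

/-- Raising the promise shows that consumption is at most `bliss`, lowering it that it is at least
`bliss`. At `ωmin` only the first is possible, but there consumption is the whole share. -/
lemma eq_ωstar_of_fixed {s : Fin (n + 2)} {ω : ℝ} (hω : ω ∈ E.promises s)
    (hg : E.g s s ω = ω) (hlt : ω < E.ωmax s) : ω = E.ωstar s := by
  have h := (E.isPolicy hω.2).1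
  have h0 : E.ω0 s ≤ ω := hg ▸ E.ω0_le_g s hω.2
  have hx := h.of_ω0_le h0
  have hxpos := h.1.pos
  have hsum := add_pos E.β_pos E.δ_pos
  have hβ := E.β_pos
  have hδ := E.δ_pos
  have h1 := E.first_order_repeated h h0 hg hlt (Or.inl rfl) (Or.inl rfl)
  have hle : E.f s ω ≤ E.bliss := by
    rw [one_mul, sub_nonpos, div_le_div_iff₀ hδ hxpos] at h1
    rw [bliss, le_div_iff₀ hsum]
    linarith
  have hstar : E.f s ω = E.cstar s := by
    rcases hω.1.eq_or_lt with he | hmin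
    · have hxs : E.f s ω = E.share s := by
        rw [hx, ← he, ωmin, Real.exp_log (E.one_sub_share_pos s)]
        ring
      rw [cstar_eq, hxs, min_eq_right (hxs ▸ hle)]
    · have h2 := E.first_order_repeated h h0 hg hlt (Or.inr rfl) (Or.inr hmin)
      have hge : E.bliss ≤ E.f s ω := by
        rw [neg_one_mul, neg_nonpos, sub_nonneg, div_le_div_iff₀ hxpos hδ] at h2
        rw [bliss, div_le_iff₀ hsum]
        linarith
      rw [cstar_eq, min_eq_left (hge.trans h.1.old)]
      exact le_antisymm hle hge
  rw [ωstar_eq, ← hstar, hx]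
  simp

/-- Without a transfer the young accept any feasible promises, so the reset promises are optimal,
and here `ω0 s` is squeezed between `ωmin s` and `ωstar s`, which agree. -/
lemma g_ωmin_of_le_bliss {s : Fin (n + 2)} (hs : E.share s ≤ E.bliss) :
    E.g s s (E.ωmin s) = E.ωmin s := by
  have hω : E.ωstar s = E.ωmin s := by rw [ωstar_eq, cstar_eq, min_eq_right hs]; rfl
  have h0 : E.ω0 s = E.ωmin s := le_antisymm (hω ▸ E.ω0_le_ωstar s) (E.ω0_mem s).1
  have h := (E.isPolicy (E.ωmin_le_ωmax s)).1
  have hx := h.of_ω0_le h0.le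
  rw [ωmin, Real.exp_log (E.one_sub_share_pos s), sub_sub_cancel] at hx
  have hf : E.Feasible s (E.ωmin s) (E.f s (E.ωmin s)) E.ω0 := by
    refine ⟨h.1.pos, h.1.keep, h.1.old, fun r => (E.ω0_mem r).2, fun r => (E.ω0_mem r).1, ?_⟩
    have : ∑ r, E.prob r * Real.log (1 - E.share r) ≤ ∑ r, E.prob r * E.ω0 r :=
      sum_le_sum fun r _ => mul_le_mul_of_nonneg_left (E.ω0_mem r).1 (E.prob_pos r).le
    have := mul_le_mul_of_nonneg_left this E.β_pos.le
    have e : E.f s (E.ωmin s) = E.share s := hx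
    rw [e, autarky]
    linarith
  have hs' : E.Solves s (E.ωmin s) (E.f s (E.ωmin s)) E.ω0 := by
    refine hf.solves ?_
    rw [← h.objective_eq]
    simp only [objective]
    gcongr with r
    · exact E.δ_pos.le
    · exact (E.prob_pos r).le
    · rw [E.value_eq_of_le_ω0 (E.ω0_mem r).1 le_rfl]
      exact E.value_anti (h.1.lower r) (h.1.upper r)
  rw [hs'.g_eq le_rfl, h0]

lemma value_le_line_right {s : Fin (n + 2)} {m u z : ℝ} (hmu : m < u) (huz : u < z)
    (hz : z ≤ E.ωmax s) :
    E.value s z - E.value s u ≤ (E.value s u - E.value s m) / (u - m) * (z - u) := by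
  have := (E.concaveOn_value s).slope_anti_adjacent (Set.mem_Iic.2 (by linarith))
    (Set.mem_Iic.2 hz) hmu huz
  exact (div_le_iff₀ (sub_pos.2 huz)).1 this

lemma value_le_line_left {s : Fin (n + 2)} {m u z : ℝ} (hmu : m < u) (hzm : z < m)
    (hu : u ≤ E.ωmax s) :
    E.value s z - E.value s m ≤ (E.value s u - E.value s m) / (u - m) * (z - m) := by
  have := (E.concaveOn_value s).slope_anti_adjacent (Set.mem_Iic.2 (by linarith))
    (Set.mem_Iic.2 hu) hzm hmu
  have := (le_div_iff₀ (sub_pos.2 hzm)).1 this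
  linarith

open Filter Topology in
lemma g_ωstar {s : Fin (n + 2)} (hlt : E.ωstar s < E.ωmax s) :
    E.g s s (E.ωstar s) = E.ωstar s := by
  rcases le_or_gt (E.share s) E.bliss with hs | hs
  · have hω : E.ωstar s = E.ωmin s := by rw [ωstar_eq, cstar_eq, min_eq_right hs]; rfl
    rw [hω, E.g_ωmin_of_le_bliss hs]
  have hcs : E.cstar s = E.bliss := min_eq_left hs.le
  have hmin : E.ωmin s < E.ωstar s := by
    rw [ωstar_eq, hcs]
    exact Real.log_lt_log (E.one_sub_share_pos s) (by linarith)
  have h := (E.isPolicy hlt.le).1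
  have h0 := E.ω0_le_ωstar s
  have hx := h.of_ω0_le h0
  rw [one_sub_exp_ωstar, hcs] at hx
  have hδ := E.δ_pos
  have hβ := E.β_pos
  have hk : (1 - E.f s (E.ωstar s)) / E.f s (E.ωstar s) = E.β / E.δ := by
    have := add_pos hβ hδ
    rw [hx, one_sub_bliss, bliss]
    field_simp
  have hone : E.δ / E.β * (E.β / E.δ) = 1 := by field_simp
  have hu0 := E.ω0_le_g s hlt.le
  have humax := h.1.upper s
  have humin := h.1.lower s
  have hfo := fun {σ A B : ℝ} => E.first_order h h0 (σ := σ) (A := A) (B := B)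
  simp only [hk, hone, sub_self, mul_zero, zero_add, one_mul] at hfo
  set u := E.g s s (E.ωstar s) with hu
  set ω := E.ωstar s with hω
  by_contra hne
  -- As `(1 - x) / x = β / δ` here, the first-order condition is just `A ≤ B`. A point `m` between
  -- `u` and `ω` splits the interval into two chords whose slopes, up to the sign `σ`, serve as `A`
  -- and `B`; strict concavity above `ω0` orders them the other way.
  rcases lt_or_gt_of_ne hne with huω | huω
  · obtain ⟨m, hm1, hm2⟩ := exists_between huω
    have hAB := (E.strictConcaveOn_value s).slope_anti_adjacent ⟨hu0, humax⟩ ⟨h0, hlt.le⟩ hm1 hm2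
    refine absurd (hfo (σ := 1) (Or.inl rfl) ?_ ?_) (not_le.2 hAB)
    · filter_upwards [E.eventually_mem_promises (Or.inl rfl) (Or.inr hlt) (Or.inl rfl)
        ⟨hmin.le, hlt.le⟩, self_mem_nhdsWithin] with ε h1 (h2 : 0 < ε)
      refine ⟨h1, ?_⟩
      have := E.value_le_line_right hm2 (z := ω + 1 * ε) (by linarith) h1.2
      simpa using this
    · have hev : ∀ᶠ ε in 𝓝[>] (0 : ℝ), ε < m - u :=
        (eventually_lt_nhds (sub_pos.2 hm1)).filter_mono nhdsWithin_le_nhds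
      filter_upwards [hev, self_mem_nhdsWithin] with ε h1 (h2 : 0 < ε)
      refine ⟨⟨by linarith, by linarith⟩, ?_⟩
      have := E.line_le_value hm1 (s := s) (z := u + 1 * ε) (by linarith) (by linarith)
        (by linarith)
      have hp := sub_pos.2 hm1
      have e : (E.value s m - E.value s u) / (m - u) * (m - u) = E.value s m - E.value s u :=
        div_mul_cancel₀ _ hp.ne'
      linarith
  · obtain ⟨m, hm1, hm2⟩ := exists_between huω
    have hAB := (E.strictConcaveOn_value s).slope_anti_adjacent ⟨h0, hlt.le⟩ ⟨hu0, humax⟩ hm1 hm2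
    refine absurd (hfo (σ := -1) (A := -((E.value s u - E.value s m) / (u - m)))
      (B := -((E.value s m - E.value s ω) / (m - ω))) (Or.inr rfl) ?_ ?_)
      (not_le.2 (neg_lt_neg hAB))
    · filter_upwards [E.eventually_mem_promises (Or.inr hmin) (Or.inl rfl) (Or.inr rfl)
        ⟨hmin.le, hlt.le⟩, self_mem_nhdsWithin] with ε h1 (h2 : 0 < ε)
      refine ⟨h1, ?_⟩
      have := E.value_le_line_left hm1 (s := s) (z := ω + -1 * ε) (by linarith) (by linarith)
      linarith
    · have hev : ∀ᶠ ε in 𝓝[>] (0 : ℝ), ε < u - m :=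
        (eventually_lt_nhds (sub_pos.2 hm2)).filter_mono nhdsWithin_le_nhds
      filter_upwards [hev, self_mem_nhdsWithin] with ε h1 (h2 : 0 < ε)
      refine ⟨⟨by linarith, by linarith⟩, ?_⟩
      have := E.line_le_value hm2 (s := s) (z := u + -1 * ε) humax (by linarith) (by linarith)
      linarith

lemma isLeast_fixedPromises (s : Fin (n + 2)) :
    IsLeast (E.fixedPromises s) (min (E.ωstar s) (E.ωmax s)) := by
  constructor
  · rcases lt_or_ge (E.ωstar s) (E.ωmax s) with h | h
    · rw [min_eq_left h.le]
      exact ⟨⟨(E.ω0_mem s).1.trans (E.ω0_le_ωstar s), h.le⟩, E.g_ωstar h⟩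
    · rw [min_eq_right h]
      exact ⟨⟨E.ωmin_le_ωmax s, le_rfl⟩, E.g_ωmax s s⟩
  · intro ω hω
    rcases hω.1.2.eq_or_lt with h | h
    · exact (min_le_right _ _).trans h.ge
    · exact (min_le_left _ _).trans (E.eq_ωstar_of_fixed hω.1 hω.2 h).ge

end Economy

end

theorem lemma3 {n : ℕ} (E : Economy n)
    -- the Perron root of the matrix of autarky state prices exceeds one
    (h_sustain : 1 < ∑ s, E.prob s * (E.β * E.share s / (1 - E.share s)))
    -- no transfer is first best in the lowest state
    (h_low : E.share 0 ≤ E.δ / (E.β + E.δ))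
    -- the first best violates the participation constraint of the young in the highest state
    (h_nofb : Real.log (E.cstar (Fin.last (n + 1)))
        + E.β * ∑ r, E.prob r * Real.log (1 - E.cstar r)
      < Real.log (E.share (Fin.last (n + 1)))
        + E.β * ∑ r, E.prob r * Real.log (1 - E.share r)) :
    -- the policy functions are well defined
    (∀ s, ∀ ω ∈ E.promises s,
      E.IsPolicy s ω (E.f s ω) (fun r => E.g r s ω) ∧
        ∀ x w, E.Solves s ω x w → x = E.f s ω) ∧
    -- (i)
    (∀ s, E.ω0 s ∈ E.promises s ∧
      ∀ ω ∈ E.promises s,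
        E.f s ω ∈ Set.Ioc 0 (E.share s) ∧
        (E.ω0 s ≤ ω → E.f s ω = 1 - Real.exp ω) ∧
        (ω < E.ω0 s → E.f s ω = 1 - Real.exp (E.ω0 s))) ∧
    -- (ii)
    ((∀ i : Fin (n + 1), E.c0 i.castSucc ≤ E.c0 i.succ) ∧
      ∃ i : Fin (n + 1), E.c0 i.castSucc < E.c0 i.succ) ∧
    -- (iii)
    (∀ s, IsLeast (E.fixedPromises s) (E.ωf s) ∧
      E.ωf s = min (E.ωstar s) (E.ωmax s) ∧
      (∀ ω ∈ E.fixedPromises s, ω = E.ωf s ∨ ω = E.ωmax s) ∧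
      E.cstar s ≤ E.f s (E.ωf s) ∧
      (E.ωf s < E.ωmax s → E.f s (E.ωf s) = E.cstar s)) := by
  have hpol := fun s => fun ω (hω : ω ∈ E.promises s) => E.isPolicy hω.2
  refine ⟨fun s ω hω => ⟨hpol s ω hω, fun x w h => h.unique (hpol s ω hω).1⟩,
    fun s => ⟨E.ω0_mem s, fun ω hω => ⟨⟨(hpol s ω hω).1.1.pos, (hpol s ω hω).1.1.old⟩,
      fun h => E.f_of_ω0_le h hω.2, fun h => E.f_of_le_ω0 hω.1 h.le⟩⟩,
    ⟨fun i => E.c0_mono_of_lt Fin.castSucc_lt_succ, E.exists_c0_lt h_low h_nofb⟩, fun s => ?_⟩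
  have hl := E.isLeast_fixedPromises s
  have hf : E.ωf s = min (E.ωstar s) (E.ωmax s) := hl.csInf_eq
  have hfv : E.f s (E.ωf s) = 1 - Real.exp (E.ωf s) := by
    rw [hf]
    exact E.f_of_ω0_le (le_min (E.ω0_le_ωstar s) (E.ω0_mem s).2) (min_le_right _ _)
  have hlt : ∀ {ω}, ω ∈ E.fixedPromises s → ω < E.ωmax s → ω = E.ωstar s :=
    fun hω h => E.eq_ωstar_of_fixed hω.1 hω.2 h
  refine ⟨hf ▸ hl, hf, fun ω hω => ?_, ?_, fun h => ?_⟩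
  · rcases hω.1.2.eq_or_lt with h | h
    · exact Or.inr h
    · have := hlt hω h
      left
      rw [hf, ← this, min_eq_left h.le]
  · rw [hfv, ← E.one_sub_exp_ωstar, hf]
    exact sub_le_sub_left (Real.exp_le_exp.2 (min_le_left _ _)) 1
  · rw [hfv, hlt (hf ▸ hl.1) h, E.one_sub_exp_ωstar]
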